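/- Digraphs $G=(V,E)$ are finite, with nonempty vertex set, and without loops or multiple arcs; $\text{co-}G$ is the complement digraph (the arcs are the ordered pairs of distinct vertices not in $E$), $un(G)$ is the underlying undirected graph, and $G\in \mathrm{Free}(X)$ means that no induced subdigraph (for undirected graphs: subgraph) of $G$ is isomorphic to a member of $X$. For vertex-disjoint digraphs, $G_1\oplus G_2$ is the disjoint union, $G_1\otimes G_2$ (series composition) is the disjoint union plus all arcs in both directions between $G_1$ and $G_2$, and $G_1\oslash G_2$ (order composition) is the disjoint union plus all arcs from $G_1$ to $G_2$; $\bullet$ is a one-vertex digraph. A digraph is a *directed threshold graph* if it can be built from $\bullet$ by the operations $G\mapsto G\oplus\bullet,\ G\oslash\bullet,\ \bullet\oslash G,\ G\otimes\bullet$. It is *directed trivially perfect* if it can be built from copies of $\bullet$ by $(G_1,G_2)\mapsto G_1\oplus G_2$ and $G\mapsto G\oslash\bullet,\ \bullet\oslash G,\ G\otimes\bullet$. An undirected graph is a *threshold graph* if it can be built from one vertex by repeatedly adding an isolated or a dominating vertex. Let $I_2$, $\overrightarrow{P_2}$, $\overleftrightarrow{K_2}$ be the digraphs on two vertices with no arc,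 one arc, and both arcs. The digraphs $D_1,\dots,D_{15}$ are: $D_1$: $a\to b\to c$; $D_2$: $a\leftrightarrow b\to c$; $D_3$: $a\leftrightarrow b\leftarrow c$; $D_4=\text{co-}D_1$; $D_5$: the directed 3-cycle; $D_7$: the bidirectional path on 4 vertices; $D_8$: $a\to b\leftarrow c\to d$; $D_6=\text{co-}D_8$; $D_9=I_2\otimes I_2$; $D_{10}=I_2\otimes\overrightarrow{P_2}$; $D_{11}=\overrightarrow{P_2}\otimes\overrightarrow{P_2}$; $D_{12}=I_2\oslash I_2$; $D_{13}=I_2\oslash\overleftrightarrow{K_2}$; $D_{14}=\overleftrightarrow{K_2}\oslash I_2$; $D_{15}=\overleftrightarrow{K_2}\oslash\overleftrightarrow{K_2}$. The *directed linear NLC-width* of $G$ is the least $k$ such that $G$, with some labelling of its vertices by $\{1,\dots,k\}$, can be built by: creating a single labelled vertex; adding to a labelled digraph $H$ a new vertex $w$ of label $a$ together with the arcs $(u,w)$ with $(\mathrm{lab}(u),a)\in S$ and the arcs $(w,u)$ with $(\mathrm{lab}(u),a)\in T$, $u\in V(H)$, for any $S,T\subseteq\{1,\dots,k\}^2$; relabelling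 by any map $\{1,\dots,k\}\to\{1,\dots,k\}$. The *directed linear clique-width* is defined in the same way with the operations: creating a single labelled vertex; adding a new isolated labelled vertex; inserting all arcs from vertices of label $a$ to vertices of label $b$, for $a\neq b$; changing all labels $a$ to $b$. The *directed neighbourhood-width* of $G$ is the minimum, over all bijections $\varphi:V\to\{1,\dots,|V|\}$, of $\max_{1\le i\le |V|}|\{(N^+(u)\cap R_i,\,N^-(u)\cap R_i) : \varphi(u)\le i\}|$, where $R_i=\{v:\varphi(v)>i\}$ and $N^+(u)$, $N^-(u)$ are the sets of out- and in-neighbours of $u$. **Theorem.** For every digraph $G$ the following are equivalent: 1. $G$ is a directed threshold graph. 2. $G\in\mathrm{Free}(\{D_1,\dots,D_{15},\text{co-}D_{11},\text{co-}D_{10},\text{co-}D_9\})$. 3. $G\in\mathrm{Free}(\{D_1,D_2,D_3,D_4,D_5,D_6,D_{10},D_{11},D_{13},D_{14},D_{15}\})$ and $un(G)\in\mathrm{Free}(\{P_4,2K_2,C_4\})$. 4. $G\in\mathrm{Free}(\{D_1,D_2,D_3,D_4,D_5,D_6,D_{10},D_{11},D_{13},D_{14},D_{15}\})$ and $un(G)$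 is a threshold graph. 5. $G$ has directed linear NLC-width $1$. 6. $G$ has directed neighbourhood-width $1$. 7. $G$ has directed linear clique-width at most $2$ and $G\in\mathrm{Free}(\{D_2,D_3,D_9,D_{10},D_{12},D_{13},D_{14}\})$. 8. $G$ and $\text{co-}G$ are both directed trivially perfect graphs. -/

import Mathlib

universe u v

/-- Digraphs without loops and without multiple arcs on the vertex set `V`. -/
structure LDigraph (V : Type u) extends Digraph V where
  loopless : ∀ v, ¬ Adj v v

namespace LDigraph

/-- The digraph with a single vertex. -/
def bullet : LDigraph PUnit.{u + 1} where
  Adj _ _ := False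
  loopless _ h := h

/-- The complement digraph: all arcs between distinct vertices that are not arcs of `G`. -/
def co {V : Type u} (G : LDigraph V) : LDigraph V where
  Adj x y := x ≠ y ∧ ¬ G.Adj x y
  loopless _ h := h.1 rfl

/-- The underlying undirected graph. -/
def un {V : Type u} (G : LDigraph V) : SimpleGraph V :=
  G.toDigraph.toSimpleGraphInclusive

/-- The disjoint union of `G` and `H` together with the arcs `(x, y)` for which `out x y` holds and
the arcs `(y, x)` for which `inn x y` holds, where `x` is a vertex of `G` and `y` one of `H`. -/
def glue {V W : Type u} (G : LDigraph V) (H : LDigraph W) (out inn : V → W → Prop) :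
    LDigraph (V ⊕ W) where
  Adj
    | Sum.inl x, Sum.inl x' => G.Adj x x'
    | Sum.inr y, Sum.inr y' => H.Adj y y'
    | Sum.inl x, Sum.inr y => out x y
    | Sum.inr y, Sum.inl x => inn x y
  loopless
    | Sum.inl x => G.loopless x
    | Sum.inr y => H.loopless y

/-- Disjoint union `G ⊕ H`. -/
def disjUnion {V W : Type u} (G : LDigraph V) (H : LDigraph W) : LDigraph (V ⊕ W) :=
  glue G H (fun _ _ => False) (fun _ _ => False)

/-- Series composition `G ⊗ H`: all arcs in both directions between `G` and `H`. -/
def series {V W : Type u} (G : LDigraph V) (H : LDigraph W) : LDigraph (V ⊕ W) :=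
  glue G H (fun _ _ => True) (fun _ _ => True)

/-- Order composition `G ⊘ H`: all arcs from `G` to `H`. -/
def order {V W : Type u} (G : LDigraph V) (H : LDigraph W) : LDigraph (V ⊕ W) :=
  glue G H (fun _ _ => True) (fun _ _ => False)

/-- Isomorphisms of digraphs. -/
abbrev Iso {V : Type u} {W : Type v} (G : LDigraph V) (H : LDigraph W) := G.Adj ≃r H.Adj

/-- `H` is isomorphic to an induced subdigraph of `G`. -/
def IsIndContained {W : Type u} {V : Type v} (H : LDigraph W) (G : LDigraph V) : Prop :=
  Nonempty (H.Adj ↪r G.Adj)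

/-! ### Classes of digraphs -/

/-- Directed threshold graphs. -/
inductive IsDirectedThreshold : {V : Type u} → LDigraph V → Prop
  | single : IsDirectedThreshold bullet
  | disjUnion {V : Type u} {G : LDigraph V} :
      IsDirectedThreshold G → IsDirectedThreshold (G.disjUnion bullet)
  | order_bullet {V : Type u} {G : LDigraph V} :
      IsDirectedThreshold G → IsDirectedThreshold (G.order bullet)
  | bullet_order {V : Type u} {G : LDigraph V} :
      IsDirectedThreshold G → IsDirectedThreshold (bullet.order G)
  | series {V : Type u} {G : LDigraph V} :
      IsDirectedThreshold G → IsDirectedThreshold (G.series bullet)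
  | iso {V W : Type u} {G : LDigraph V} {H : LDigraph W} :
      Iso G H → IsDirectedThreshold G → IsDirectedThreshold H

/-- Directed trivially perfect graphs. -/
inductive IsDirectedTriviallyPerfect : {V : Type u} → LDigraph V → Prop
  | single : IsDirectedTriviallyPerfect bullet
  | disjUnion {V W : Type u} {G : LDigraph V} {H : LDigraph W} :
      IsDirectedTriviallyPerfect G → IsDirectedTriviallyPerfect H →
        IsDirectedTriviallyPerfect (G.disjUnion H)
  | order_bullet {V : Type u} {G : LDigraph V} :
      IsDirectedTriviallyPerfect G → IsDirectedTriviallyPerfect (G.order bullet)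
  | bullet_order {V : Type u} {G : LDigraph V} :
      IsDirectedTriviallyPerfect G → IsDirectedTriviallyPerfect (bullet.order G)
  | series {V : Type u} {G : LDigraph V} :
      IsDirectedTriviallyPerfect G → IsDirectedTriviallyPerfect (G.series bullet)
  | iso {V W : Type u} {G : LDigraph V} {H : LDigraph W} :
      Iso G H → IsDirectedTriviallyPerfect G → IsDirectedTriviallyPerfect H

/-! ### Forbidden induced subdigraphs -/

/-- Digraphs with vertex set `{0, …, n - 1}` for some `n`. -/
abbrev FinDigraph : Type := Σ n : ℕ, LDigraph (Fin n)

/-- The digraph on `{0, …, n - 1}` with the arcs listed in `A`. -/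
def ofArcs (n : ℕ) (A : List (Fin n × Fin n)) : FinDigraph :=
  ⟨n, { Adj := fun x y => x ≠ y ∧ (x, y) ∈ A
        loopless := fun _ h => h.1 rfl }⟩

/-- The complement of a member of `FinDigraph`. -/
def coFin (F : FinDigraph) : FinDigraph := ⟨F.1, F.2.co⟩

/-- `G` belongs to `Free(X)`: no induced subdigraph of `G` is isomorphic to a member of `X`. -/
def Free (X : Set FinDigraph) {V : Type u} (G : LDigraph V) : Prop :=
  ∀ F ∈ X, ¬ F.2.IsIndContained G

/-- The path `0 → 1 → 2`. -/
def D1 : FinDigraph := ofArcs 3 [(0, 1), (1, 2)]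

/-- `0 ↔ 1 → 2`. -/
def D2 : FinDigraph := ofArcs 3 [(0, 1), (1, 0), (1, 2)]

/-- `0 ↔ 1 ← 2`. -/
def D3 : FinDigraph := ofArcs 3 [(0, 1), (1, 0), (2, 1)]

/-- `0 ↔ 1` together with `0 → 2 → 1`; this is the complement of the path on three vertices. -/
def D4 : FinDigraph := ofArcs 3 [(0, 1), (1, 0), (0, 2), (2, 1)]

/-- The directed cycle on three vertices. -/
def D5 : FinDigraph := ofArcs 3 [(0, 1), (1, 2), (2, 0)]

/-- The bidirectional path on four vertices. -/
def D7 : FinDigraph := ofArcs 4 [(0, 1), (1, 0), (1, 2), (2, 1), (2, 3), (3, 2)]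

/-- The transitive orientation `0 → 1 ← 2 → 3` of the path on four vertices. -/
def D8 : FinDigraph := ofArcs 4 [(0, 1), (2, 1), (2, 3)]

/-- The complement of `D8`. -/
def D6 : FinDigraph := coFin D8

/-- `I₂ ⊗ I₂`, where `I₂` is the edgeless digraph on two vertices: the bidirectional cycle on four
vertices. -/
def D9 : FinDigraph :=
  ofArcs 4 [(0, 2), (0, 3), (1, 2), (1, 3), (2, 0), (3, 0), (2, 1), (3, 1)]

/-- `I₂ ⊗ P₂`, where `P₂` is a single arc. -/
def D10 : FinDigraph :=
  ofArcs 4 [(0, 2), (0, 3), (1, 2), (1, 3), (2, 0), (3, 0), (2, 1), (3, 1), (2, 3)]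

/-- `P₂ ⊗ P₂`, where `P₂` is a single arc. -/
def D11 : FinDigraph :=
  ofArcs 4 [(0, 2), (0, 3), (1, 2), (1, 3), (2, 0), (3, 0), (2, 1), (3, 1), (0, 1), (2, 3)]

/-- `I₂ ⊘ I₂`. -/
def D12 : FinDigraph := ofArcs 4 [(0, 2), (0, 3), (1, 2), (1, 3)]

/-- `I₂ ⊘ K₂`, where `K₂` is the bidirectional complete digraph on two vertices. -/
def D13 : FinDigraph := ofArcs 4 [(0, 2), (0, 3), (1, 2), (1, 3), (2, 3), (3, 2)]

/-- `K₂ ⊘ I₂`. -/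
def D14 : FinDigraph := ofArcs 4 [(0, 2), (0, 3), (1, 2), (1, 3), (0, 1), (1, 0)]

/-- `K₂ ⊘ K₂`. -/
def D15 : FinDigraph :=
  ofArcs 4 [(0, 2), (0, 3), (1, 2), (1, 3), (0, 1), (1, 0), (2, 3), (3, 2)]

/-! ### Directed linear NLC-width -/

/-- The digraphs `G` with vertex labels in `{0, …, k - 1}` that can be built by creating a labelled
vertex, by adding a vertex with label `a` together with the arcs to and from it prescribed by two
relations on the labels, and by relabelling with an arbitrary map. -/
inductive LinearNLC (k : ℕ) : {V : Type u} → LDigraph V → (V → Fin k) → Prop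
  | single (a : Fin k) : LinearNLC k bullet (fun _ => a)
  | add {V : Type u} {G : LDigraph V} {lab : V → Fin k} (a : Fin k)
      (S T : Set (Fin k × Fin k)) :
      LinearNLC k G lab →
        LinearNLC k (G.glue bullet (fun x _ => (lab x, a) ∈ S) (fun x _ => (lab x, a) ∈ T))
          (Sum.elim lab fun _ => a)
  | relabel {V : Type u} {G : LDigraph V} {lab : V → Fin k} (R : Fin k → Fin k) :
      LinearNLC k G lab → LinearNLC k G (fun x => R (lab x))
  | iso {V W : Type u} {G : LDigraph V} {H : LDigraph W} {lab : V → Fin k} (e : Iso G H) :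
      LinearNLC k G lab → LinearNLC k H (fun y => lab (e.symm y))

/-- The least number of labels that suffices to build `G` by the operations of `LinearNLC`. -/
noncomputable def linearNLCWidth {V : Type u} (G : LDigraph V) : ℕ∞ :=
  ⨅ k : {k : ℕ // ∃ lab : V → Fin k, LinearNLC k G lab}, (k.1 : ℕ∞)

/-! ### Directed linear clique-width -/

/-- Insert all arcs from vertices with label `a` to vertices with label `b`. -/
def insertArcs {V : Type u} {k : ℕ} (G : LDigraph V) (lab : V → Fin k) (a b : Fin k)
    (hab : a ≠ b) : LDigraph V where
  Adj x y := G.Adj x y ∨ (lab x = a ∧ lab y = b)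
  loopless x h := h.elim (G.loopless x) fun h => hab (h.1.symm.trans h.2)

/-- The digraphs `G` with vertex labels in `{0, …, k - 1}` that can be built by creating a labelled
vertex, by adding an isolated labelled vertex, by inserting all arcs from label `a` to label `b` for
`a ≠ b`, and by changing label `a` into label `b`. -/
inductive LinearCW (k : ℕ) : {V : Type u} → LDigraph V → (V → Fin k) → Prop
  | single (a : Fin k) : LinearCW k bullet (fun _ => a)
  | add {V : Type u} {G : LDigraph V} {lab : V → Fin k} (a : Fin k) :
      LinearCW k G lab → LinearCW k (G.disjUnion bullet) (Sum.elim lab fun _ => a)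
  | insertArcs {V : Type u} {G : LDigraph V} {lab : V → Fin k} (a b : Fin k) (hab : a ≠ b) :
      LinearCW k G lab → LinearCW k (G.insertArcs lab a b hab) lab
  | relabel {V : Type u} {G : LDigraph V} {lab : V → Fin k} (a b : Fin k) :
      LinearCW k G lab → LinearCW k G (fun x => if lab x = a then b else lab x)
  | iso {V W : Type u} {G : LDigraph V} {H : LDigraph W} {lab : V → Fin k} (e : Iso G H) :
      LinearCW k G lab → LinearCW k H (fun y => lab (e.symm y))

/-- The least number of labels that suffices to build `G` by the operations of `LinearCW`. -/
noncomputable def linearCliqueWidth {V : Type u} (G : LDigraph V) : ℕ∞ :=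
  ⨅ k : {k : ℕ // ∃ lab : V → Fin k, LinearCW k G lab}, (k.1 : ℕ∞)

/-! ### Directed neighbourhood-width -/

/-- The directed neighbourhood of `x` into `W`: its out-neighbours in `W` and its in-neighbours
in `W`. -/
def nbhd {V : Type u} (G : LDigraph V) (W : Set V) (x : V) : Set V × Set V :=
  ({y ∈ W | G.Adj x y}, {y ∈ W | G.Adj y x})

/-- The width of a linear layout `φ` of the vertices: the largest number, over all positions `i`,
of distinct directed neighbourhoods that the vertices at positions up to `i` have into the set of
the vertices at later positions. -/
noncomputable def layoutWidth {V : Type u} (G : LDigraph V) (φ : V ≃ Fin (Nat.card V)) : ℕ∞ :=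
  ⨆ i : Fin (Nat.card V), (G.nbhd {y | i < φ y} '' {x | φ x ≤ i}).encard

/-- The least width of a linear layout of the vertices. -/
noncomputable def neighbourhoodWidth {V : Type u} (G : LDigraph V) : ℕ∞ :=
  ⨅ φ : V ≃ Fin (Nat.card V), G.layoutWidth φ

end LDigraph

/-- Undirected threshold graphs: built from a single vertex by adding isolated vertices and
dominating vertices. -/
inductive IsThreshold : {V : Type u} → SimpleGraph V → Prop
  | single : IsThreshold (⊥ : SimpleGraph PUnit.{u + 1})
  | disjUnion {V : Type u} {G : SimpleGraph V} :
      IsThreshold G → IsThreshold (G.sum (⊥ : SimpleGraph PUnit.{u + 1}))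
  | join {V : Type u} {G : SimpleGraph V} :
      IsThreshold G →
        IsThreshold (G.sum (⊥ : SimpleGraph PUnit.{u + 1}) ⊔ completeBipartiteGraph V PUnit.{u + 1})
  | iso {V W : Type u} {G : SimpleGraph V} {H : SimpleGraph W} :
      G ≃g H → IsThreshold G → IsThreshold H

/-- The disjoint union `2K₂` of two edges. -/
def twoK2 : SimpleGraph (Fin 2 ⊕ Fin 2) := (SimpleGraph.completeGraph (Fin 2)).sum
  (SimpleGraph.completeGraph (Fin 2))

open LDigraph

/-! Call a vertex uniform if it is joined in one and the same way (no arc, only outgoing, only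
incoming, or both) to all other vertices. The four threshold operations are exactly the four ways of
adding a uniform vertex. So for finite nonempty `G`, being a directed threshold graph amounts to
`HasUniform`: every nonempty set of vertices has a member uniform within the set. This condition
passes to induced subdigraphs and to complements. NLC-width 1 and neighbourhood-width 1 are other
descriptions of such an elimination order, and the forbidden digraphs are excluded because none of
them has a uniform vertex.

The hard direction is `Free.exists_uniform`: a finite nonempty digraph without the forbidden
subdigraphs has a uniform vertex. By `Free.not_alternating` the underlying graph has no alternating
4-cycle, so a vertex of maximum degree forces an isolated or a dominating vertex. The forbidden list
is closed under complement, so the same holds for `G.co`. If there is no uniform vertex, this leaves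
a vertex `u` adjacent to everything and a vertex `w` on no bidirectional arc, and then one of the
two has only single arcs, to all other vertices (`Free.exists_all_singleArc`). The vertices of this
kind are linearly ordered by their arcs. Since none is a source or a sink, the first has two
predecessors not joined by a single arc, and the last has two such successors. Transitivity sends
all single arcs from the former pair to the latter, which gives `D12`, `D13`, `D14` or `D15`.

For trivially perfect digraphs, an induced subdigraph without a uniform vertex would be disconnected
both in `G` and in `G.co`, which is impossible. For clique-width 2, the last inserted vertex of a
set satisfies the weaker condition `IsTwoLabelLast`, which already excludes every forbidden digraph
not listed explicitly in that item. -/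

/-! ### Uniform vertices and elimination orders -/

/-- In the relation `r`, the vertex `v` is related in the same way to all other vertices of `S`. -/
def IsUniformIn {V : Type*} (r : V → V → Prop) (S : Set V) (v : V) : Prop :=
  ∀ x ∈ S, ∀ y ∈ S, x ≠ v → y ≠ v → (r v x ↔ r v y) ∧ (r x v ↔ r y v)

/-- Every nonempty set of vertices has a member related in the same way to all the others. -/
def HasUniform {V : Type*} (r : V → V → Prop) : Prop :=
  ∀ S : Set V, S.Nonempty → ∃ v ∈ S, IsUniformIn r S v

lemma HasUniform.of_embedding {V W : Type*} {r : V → V → Prop} {s : W → W → Prop}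
    (h : HasUniform r) (e : s ↪r r) : HasUniform s := by
  intro S hS
  obtain ⟨_, ⟨v, hv, rfl⟩, hu⟩ := h (e '' S) (hS.image e)
  refine ⟨v, hv, fun x hx y hy hxv hyv => ?_⟩
  have := hu (e x) ⟨x, hx, rfl⟩ (e y) ⟨y, hy, rfl⟩ (e.injective.ne hxv) (e.injective.ne hyv)
  simpa only [e.map_rel_iff] using this

lemma HasUniform.exists_vertex {V : Type*} [Nonempty V] {r : V → V → Prop} (h : HasUniform r) :
    ∃ v, ∀ x y, x ≠ v → y ≠ v → (r v x ↔ r v y) ∧ (r x v ↔ r y v) := by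
  obtain ⟨v, -, hv⟩ := h Set.univ Set.univ_nonempty
  exact ⟨v, fun x y => hv x trivial y trivial⟩

lemma HasUniform.of_subsingleton {V : Type*} [Subsingleton V] (r : V → V → Prop) :
    HasUniform r :=
  fun _ ⟨v, hv⟩ => ⟨v, hv, fun _ _ _ _ hx => (hx (Subsingleton.elim _ _)).elim⟩

/-- Adding a vertex that is uniform to all the others. -/
lemma HasUniform.add_vertex {V W : Type*} {r : V → V → Prop} {s : W → W → Prop}
    (h : HasUniform r) (f : V → W) (w : W) (hf : ∀ x y, s (f x) (f y) ↔ r x y)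
    (hw : ∀ z, z ≠ w → ∃ x, f x = z) (hu : IsUniformIn s Set.univ w) : HasUniform s := by
  intro S hS
  by_cases hwS : w ∈ S
  · exact ⟨w, hwS, fun x _ y _ => hu x trivial y trivial⟩
  · have hsurj : ∀ z ∈ S, ∃ x, f x = z := fun z hz => hw z fun h => hwS (h ▸ hz)
    obtain ⟨z, hz⟩ := hS
    obtain ⟨x, rfl⟩ := hsurj z hz
    obtain ⟨v, hv, hvu⟩ := h (f ⁻¹' S) ⟨x, hz⟩
    refine ⟨f v, hv, fun a ha b hb hav hbv => ?_⟩
    obtain ⟨a, rfl⟩ := hsurj a ha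
    obtain ⟨b, rfl⟩ := hsurj b hb
    simpa only [hf] using hvu a ha b hb (fun h => hav (h ▸ rfl)) (fun h => hbv (h ▸ rfl))

lemma IsThreshold.hasUniform {V : Type u} {G : SimpleGraph V} (h : IsThreshold G) :
    HasUniform G.Adj := by
  induction h with
  | single => exact .of_subsingleton _
  | disjUnion _ ih =>
    refine ih.add_vertex Sum.inl (Sum.inr PUnit.unit) (by simp) (by simp) ?_
    rintro (x | x) - (y | y) - <;> simp
  | join _ ih =>
    refine ih.add_vertex Sum.inl (Sum.inr PUnit.unit) (by simp) (by simp) ?_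
    rintro (x | x) - (y | y) - <;> simp
  | iso e _ ih => exact ih.of_embedding e.symm.toRelEmbedding

namespace LDigraph

lemma un_adj {V : Type u} (G : LDigraph V) (x y : V) :
    G.un.Adj x y ↔ G.Adj x y ∨ G.Adj y x := by
  have := G.loopless x
  rw [un, Digraph.toSimpleGraphInclusive, SimpleGraph.fromRel_adj]
  grind

lemma ne_of_adj {V : Type u} (G : LDigraph V) {x y : V} (h : G.Adj x y) : x ≠ y := by
  rintro rfl
  exact G.loopless x h

/-- The subdigraph induced by a set of vertices. -/
def induce {V : Type u} (G : LDigraph V) (S : Set V) : LDigraph S where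
  Adj x y := G.Adj x y
  loopless x := G.loopless x

/-- The embedding of an induced subdigraph. -/
def induceEmbedding {V : Type u} (G : LDigraph V) (S : Set V) : (G.induce S).Adj ↪r G.Adj :=
  ⟨Function.Embedding.subtype _, Iff.rfl⟩

/-- The truth values of `p` and `q` encode the four threshold operations, so one argument serves all
of them; a bullet placed on the left is handled through `glueComm`. -/
lemma _root_.HasUniform.glue_bullet {V : Type u} {G : LDigraph V} (h : HasUniform G.Adj) (p q : Prop) :
    HasUniform (G.glue bullet (fun _ _ => p) (fun _ _ => q)).Adj := by
  refine h.add_vertex Sum.inl (Sum.inr PUnit.unit) (fun _ _ => Iff.rfl) (by simp) ?_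
  rintro (x | x) - (y | y) - <;> simp [glue]

/-- The order of the two parts of a composition does not matter. -/
def glueComm {V W : Type u} (G : LDigraph V) (H : LDigraph W) (p q : V → W → Prop) :
    Iso (G.glue H p q) (H.glue G (fun y x => q x y) (fun y x => p x y)) where
  toEquiv := Equiv.sumComm V W
  map_rel_iff' := by rintro (a | a) (b | b) <;> exact Iff.rfl

lemma IsDirectedThreshold.hasUniform {V : Type u} {G : LDigraph V} (h : IsDirectedThreshold G) :
    HasUniform G.Adj := by
  induction h with
  | single => exact .of_subsingleton _
  | disjUnion _ ih => exact ih.glue_bullet _ _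
  | order_bullet _ ih => exact ih.glue_bullet _ _
  | bullet_order _ ih =>
    -- Once the bullet is moved to the right, no arc enters it and all arcs leave it, hence `False`
    -- and `True`.
    exact (ih.glue_bullet False True).of_embedding (glueComm _ _ _ _).toRelEmbedding
  | series _ ih => exact ih.glue_bullet _ _
  | iso e _ ih => exact ih.of_embedding e.symm.toRelEmbedding

lemma IsDirectedThreshold.glue_bullet {V : Type u} {G : LDigraph V} (h : IsDirectedThreshold G)
    (p q : Prop) : IsDirectedThreshold (G.glue bullet (fun _ _ => p) (fun _ _ => q)) := by
  by_cases hp : p <;> by_cases hq : q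
  · rw [eq_true hp, eq_true hq]
    exact h.series
  · rw [eq_true hp, eq_false hq]
    exact h.order_bullet
  · rw [eq_false hp, eq_true hq]
    exact .iso (glueComm _ _ _ _) h.bullet_order
  · rw [eq_false hp, eq_false hq]
    exact h.disjUnion

/-- A digraph is recovered from a uniform vertex and the digraph induced by the other vertices. -/
lemma nonempty_iso_glue_bullet {V : Type u} (G : LDigraph V) (v : V) (p q : Prop)
    (hp : ∀ x, x ≠ v → (G.Adj x v ↔ p)) (hq : ∀ x, x ≠ v → (G.Adj v x ↔ q)) :
    Nonempty (Iso ((G.induce {x | x ≠ v}).glue bullet (fun _ _ => p) (fun _ _ => q)) G) := by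
  refine ⟨⟨Equiv.ofBijective (Sum.elim Subtype.val fun _ => v) ⟨?_, fun x => ?_⟩, ?_⟩⟩
  · rintro (⟨a, ha⟩ | a) (⟨b, hb⟩ | b) h
    · exact congrArg Sum.inl (Subtype.ext h)
    · exact (ha h).elim
    · exact (hb h.symm).elim
    · rfl
  · by_cases h : x = v
    · exact ⟨Sum.inr PUnit.unit, h.symm⟩
    · exact ⟨Sum.inl ⟨x, h⟩, rfl⟩
  · rintro (⟨a, ha⟩ | a) (⟨b, hb⟩ | b)
    · exact Iff.rfl
    · exact hp a ha
    · exact hq b hb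
    · exact iff_of_false (G.loopless v) id

theorem isDirectedThreshold_of_hasUniform {V : Type u} [Finite V] [Nonempty V] {G : LDigraph V}
    (h : HasUniform G.Adj) : IsDirectedThreshold G := by
  induction hn : Nat.card V using Nat.strong_induction_on generalizing V with
  | _ n ih =>
    obtain ⟨v, hv⟩ := h.exists_vertex
    by_cases hs : ∃ x, x ≠ v
    · obtain ⟨x, hx⟩ := hs
      have : Nonempty ({x | x ≠ v} : Set V) := ⟨⟨x, hx⟩⟩
      obtain ⟨e⟩ := G.nonempty_iso_glue_bullet v (G.Adj x v) (G.Adj v x)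
        (fun y hy => (hv y x hy hx).2) (fun y hy => (hv y x hy hx).1)
      refine .iso e (IsDirectedThreshold.glue_bullet ?_ _ _)
      refine ih _ ?_ (h.of_embedding (G.induceEmbedding _)) rfl
      rw [← hn]
      exact Set.ncard_lt_card (by simp [Set.ne_univ_iff_exists_notMem])
    · push Not at hs
      refine .iso (G := bullet) ⟨⟨fun _ => v, fun _ => PUnit.unit, fun _ => rfl,
        fun x => (hs x).symm⟩, ?_⟩ .single
      exact fun {a b} => iff_of_false (G.loopless v) id

end LDigraph

/-! ### The forbidden digraphs: no uniform vertex, underlying graphs, complements -/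

namespace LDigraph

instance (n : ℕ) (A : List (Fin n × Fin n)) : DecidableRel (ofArcs n A).2.Adj :=
  fun (x y : Fin n) => inferInstanceAs (Decidable (x ≠ y ∧ (x, y) ∈ A))

instance (F : FinDigraph) [DecidableRel F.2.Adj] : DecidableRel (coFin F).2.Adj :=
  fun (x y : Fin F.1) => inferInstanceAs (Decidable (x ≠ y ∧ ¬ F.2.Adj x y))

instance : DecidableRel D1.2.Adj := inferInstanceAs (DecidableRel (ofArcs _ _).2.Adj)
instance : DecidableRel D2.2.Adj := inferInstanceAs (DecidableRel (ofArcs _ _).2.Adj)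
instance : DecidableRel D3.2.Adj := inferInstanceAs (DecidableRel (ofArcs _ _).2.Adj)
instance : DecidableRel D4.2.Adj := inferInstanceAs (DecidableRel (ofArcs _ _).2.Adj)
instance : DecidableRel D5.2.Adj := inferInstanceAs (DecidableRel (ofArcs _ _).2.Adj)
instance : DecidableRel D7.2.Adj := inferInstanceAs (DecidableRel (ofArcs _ _).2.Adj)
instance : DecidableRel D8.2.Adj := inferInstanceAs (DecidableRel (ofArcs _ _).2.Adj)
instance : DecidableRel D6.2.Adj := inferInstanceAs (DecidableRel (coFin D8).2.Adj)
instance : DecidableRel D9.2.Adj := inferInstanceAs (DecidableRel (ofArcs _ _).2.Adj)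
instance : DecidableRel D10.2.Adj := inferInstanceAs (DecidableRel (ofArcs _ _).2.Adj)
instance : DecidableRel D11.2.Adj := inferInstanceAs (DecidableRel (ofArcs _ _).2.Adj)
instance : DecidableRel D12.2.Adj := inferInstanceAs (DecidableRel (ofArcs _ _).2.Adj)
instance : DecidableRel D13.2.Adj := inferInstanceAs (DecidableRel (ofArcs _ _).2.Adj)
instance : DecidableRel D14.2.Adj := inferInstanceAs (DecidableRel (ofArcs _ _).2.Adj)
instance : DecidableRel D15.2.Adj := inferInstanceAs (DecidableRel (ofArcs _ _).2.Adj)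

instance {V : Type u} [DecidableEq V] (G : LDigraph V) [DecidableRel G.Adj] :
    DecidableRel G.un.Adj :=
  fun x y => inferInstanceAs (Decidable (x ≠ y ∧ (G.Adj x y ∨ G.Adj y x)))

/-- An induced copy of `F` would inherit a uniform vertex. The hypothesis `hF` denies this in a form
that `decide` can check on a concrete `F`. -/
lemma not_isIndContained_of_hasUniform {V : Type u} {G : LDigraph V} (h : HasUniform G.Adj)
    (F : FinDigraph)
    (hF : ∀ v, ∃ x y, x ≠ v ∧ y ≠ v ∧
      ¬ ((F.2.Adj v x ↔ F.2.Adj v y) ∧ (F.2.Adj x v ↔ F.2.Adj y v)))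
    [Nonempty (Fin F.1)] : ¬ F.2.IsIndContained G := by
  rintro ⟨e⟩
  obtain ⟨v, hv⟩ := (h.of_embedding e).exists_vertex
  obtain ⟨x, y, hx, hy, hxy⟩ := hF v
  exact hxy (hv x y hx hy)

/-- The forbidden induced subdigraphs of directed threshold graphs. -/
abbrev forbidden : Set FinDigraph :=
  {D1, D2, D3, D4, D5, D6, D7, D8, D9, D10, D11, D12, D13, D14, D15,
    coFin D11, coFin D10, coFin D9}

theorem free_of_hasUniform {V : Type u} {G : LDigraph V} (h : HasUniform G.Adj) : Free forbidden G := by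
  rintro F (rfl | rfl | rfl | rfl | rfl | rfl | rfl | rfl | rfl | rfl | rfl | rfl | rfl | rfl | rfl |
    rfl | rfl | rfl)
  all_goals
    refine @not_isIndContained_of_hasUniform _ _ h _ (by decide) ⟨⟨0, by decide⟩⟩

lemma not_isIndContained_un_of_hasUniform {V : Type u} {W : Type v} [Nonempty W]
    {G : SimpleGraph V} (h : HasUniform G.Adj) (F : SimpleGraph W)
    (hF : ∀ v, ∃ x y, x ≠ v ∧ y ≠ v ∧ ¬ (F.Adj v x ↔ F.Adj v y)) : ¬ F.IsIndContained G := by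
  rintro ⟨e⟩
  obtain ⟨v, hv⟩ := (h.of_embedding e).exists_vertex
  obtain ⟨x, y, hx, hy, hxy⟩ := hF v
  exact hxy (hv x y hx hy).1

instance : DecidableRel twoK2.Adj
  | Sum.inl x, Sum.inl y => inferInstanceAs (Decidable (x ≠ y))
  | Sum.inr x, Sum.inr y => inferInstanceAs (Decidable (x ≠ y))
  | Sum.inl _, Sum.inr _ => isFalse (by simp [twoK2])
  | Sum.inr _, Sum.inl _ => isFalse (by simp [twoK2])

instance : DecidableRel (SimpleGraph.pathGraph 4).Adj :=
  fun _ _ => decidable_of_iff _ SimpleGraph.pathGraph_adj.symm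

theorem un_free_of_hasUniform {V : Type u} {G : SimpleGraph V} (h : HasUniform G.Adj) :
    ¬ (SimpleGraph.pathGraph 4).IsIndContained G ∧ ¬ twoK2.IsIndContained G ∧
      ¬ (SimpleGraph.cycleGraph 4).IsIndContained G := by
  refine ⟨?_, ?_, ?_⟩ <;> refine not_isIndContained_un_of_hasUniform h _ ?_
  · decide
  · decide
  · decide

lemma IsIndContained.un {W : Type u} {V : Type v} {H : LDigraph W} {G : LDigraph V}
    (h : H.IsIndContained G) : H.un.IsIndContained G.un := by
  obtain ⟨e⟩ := h
  refine ⟨⟨e.toEmbedding, fun {a b} => ?_⟩⟩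
  have h1 := e.map_rel_iff (a := a) (b := b)
  have h2 := e.map_rel_iff (a := b) (b := a)
  simp only [un_adj, RelEmbedding.coe_toEmbedding, h1, h2]

/-- The separate size `n` with `hn` lets the vertex map be written in a literal `Fin n`, while `F.1`
is hidden behind a definition. `isIndContained_of_map` has the same form for the same reason. -/
lemma isIndContained_un {W : Type u} {H : SimpleGraph W} {F : FinDigraph} {n : ℕ} (f : W → Fin n)
    (hn : n = F.1) (hf : ∀ a b, f a = f b → a = b)
    (h : ∀ a b, F.2.un.Adj (Fin.cast hn (f a)) (Fin.cast hn (f b)) ↔ H.Adj a b) :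
    H.IsIndContained F.2.un :=
  ⟨⟨⟨fun a => Fin.cast hn (f a), fun _ _ hab => hf _ _ (Fin.cast_injective hn hab)⟩, h _ _⟩⟩

lemma isIndContained_of_map {F F' : FinDigraph} {n : ℕ} (f : Fin n → Fin n)
    (hn : n = F'.1) (hm : F.1 = n) (hf : ∀ a b, f a = f b → a = b)
    (h : ∀ a b, F'.2.Adj (Fin.cast hn (f (Fin.cast hm a))) (Fin.cast hn (f (Fin.cast hm b))) ↔
      F.2.Adj a b) :
    F.2.IsIndContained F'.2 :=
  ⟨⟨⟨fun a => Fin.cast hn (f (Fin.cast hm a)), fun _ _ hab =>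
    Fin.cast_injective hm (hf _ _ (Fin.cast_injective hn hab))⟩, h _ _⟩⟩

/-- Each forbidden digraph missing from the short list has a forbidden underlying graph: `D7` and
`D8` give the path, `D9` and `D12` the 4-cycle, and the three complements give `twoK2`. -/
theorem free_of_un_free {V : Type u} {G : LDigraph V}
    (hG : Free {D1, D2, D3, D4, D5, D6, D10, D11, D13, D14, D15} G)
    (hP : ¬ (SimpleGraph.pathGraph 4).IsIndContained G.un)
    (hK : ¬ twoK2.IsIndContained G.un)
    (hC : ¬ (SimpleGraph.cycleGraph 4).IsIndContained G.un) : Free forbidden G := by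
  have hK' : ∀ F : FinDigraph, twoK2.IsIndContained F.2.un → ¬ F.2.IsIndContained G :=
    fun F hF h => hK (hF.trans h.un)
  have hP' : ∀ F : FinDigraph, (SimpleGraph.pathGraph 4).IsIndContained F.2.un →
    ¬ F.2.IsIndContained G := fun F hF h => hP (hF.trans h.un)
  have hC' : ∀ F : FinDigraph, (SimpleGraph.cycleGraph 4).IsIndContained F.2.un →
    ¬ F.2.IsIndContained G := fun F hF h => hC (hF.trans h.un)
  rintro F (rfl | rfl | rfl | rfl | rfl | rfl | rfl | rfl | rfl | rfl | rfl | rfl | rfl | rfl | rfl |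
    rfl | rfl | rfl)
  · exact hG D1 (by simp)
  · exact hG D2 (by simp)
  · exact hG D3 (by simp)
  · exact hG D4 (by simp)
  · exact hG D5 (by simp)
  · exact hG D6 (by simp)
  · exact hP' _
      (isIndContained_un (![0, 1, 2, 3] : Fin 4 → Fin 4) rfl (by decide) (by decide))
  · exact hP' _
      (isIndContained_un (![0, 1, 2, 3] : Fin 4 → Fin 4) rfl (by decide) (by decide))
  · exact hC' _
      (isIndContained_un (![0, 2, 1, 3] : Fin 4 → Fin 4) rfl (by decide) (by decide))
  · exact hG D10 (by simp)
  · exact hG D11 (by simp)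
  · exact hC' _
      (isIndContained_un (![0, 2, 1, 3] : Fin 4 → Fin 4) rfl (by decide) (by decide))
  · exact hG D13 (by simp)
  · exact hG D14 (by simp)
  · exact hG D15 (by simp)
  · exact hK' _
      (isIndContained_un (Sum.elim ![0, 1] ![2, 3] : Fin 2 ⊕ Fin 2 → Fin 4) rfl (by decide) (by decide))
  · exact hK' _
      (isIndContained_un (Sum.elim ![0, 1] ![2, 3] : Fin 2 ⊕ Fin 2 → Fin 4) rfl (by decide) (by decide))
  · exact hK' _
      (isIndContained_un (Sum.elim ![0, 1] ![2, 3] : Fin 2 ⊕ Fin 2 → Fin 4) rfl (by decide) (by decide))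

/-- The forbidden induced subdigraphs are closed under complementation. -/
theorem Free.co {V : Type u} {G : LDigraph V}
    (h : Free forbidden G) : Free forbidden G.co := by
  -- A copy of `F` in `G.co` is a copy of the complement of `F` in `G`. The cases below pair each
  -- digraph with its complement; `D2`, `D3`, `D5`, `D7`, `D13` and `D14` are self-complementary.
  have key : ∀ F F' : FinDigraph, ¬ F'.2.IsIndContained G →
      F'.2.IsIndContained (coFin F).2 → ¬ F.2.IsIndContained G.co := by
    rintro F F' hF' ⟨e⟩ ⟨f⟩
    refine hF' ⟨e.trans ⟨f.toEmbedding, @fun (a b : Fin F.1) => ?_⟩⟩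
    have h1 : f a ≠ f b ∧ ¬ G.Adj (f a) (f b) ↔ F.2.Adj a b := f.map_rel_iff
    change G.Adj (f a) (f b) ↔ a ≠ b ∧ ¬ F.2.Adj a b
    rw [← f.injective.ne_iff, ← h1]
    have := G.ne_of_adj (x := f a) (y := f b)
    tauto
  rintro F (rfl | rfl | rfl | rfl | rfl | rfl | rfl | rfl | rfl | rfl | rfl | rfl | rfl | rfl | rfl |
    rfl | rfl | rfl)
  · exact key D1 D4 (h _ (by simp [forbidden]))
      (isIndContained_of_map (![2, 0, 1] : Fin 3 → Fin 3) rfl rfl (by decide) (by decide))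
  · exact key D2 D2 (h _ (by simp [forbidden]))
      (isIndContained_of_map (![0, 2, 1] : Fin 3 → Fin 3) rfl rfl (by decide) (by decide))
  · exact key D3 D3 (h _ (by simp [forbidden]))
      (isIndContained_of_map (![0, 2, 1] : Fin 3 → Fin 3) rfl rfl (by decide) (by decide))
  · exact key D4 D1 (h _ (by simp [forbidden]))
      (isIndContained_of_map (![1, 2, 0] : Fin 3 → Fin 3) rfl rfl (by decide) (by decide))
  · exact key D5 D5 (h _ (by simp [forbidden]))
      (isIndContained_of_map (![0, 2, 1] : Fin 3 → Fin 3) rfl rfl (by decide) (by decide))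
  · exact key D6 D8 (h _ (by simp [forbidden]))
      (isIndContained_of_map (![0, 1, 2, 3] : Fin 4 → Fin 4) rfl rfl (by decide) (by decide))
  · exact key D7 D7 (h _ (by simp [forbidden]))
      (isIndContained_of_map (![1, 3, 0, 2] : Fin 4 → Fin 4) rfl rfl (by decide) (by decide))
  · exact key D8 D6 (h _ (by simp [forbidden]))
      (isIndContained_of_map (![0, 1, 2, 3] : Fin 4 → Fin 4) rfl rfl (by decide) (by decide))
  · exact key D9 (coFin D9) (h _ (by simp [forbidden]))
      (isIndContained_of_map (![0, 1, 2, 3] : Fin 4 → Fin 4) rfl rfl (by decide) (by decide))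
  · exact key D10 (coFin D10) (h _ (by simp [forbidden]))
      (isIndContained_of_map (![0, 1, 2, 3] : Fin 4 → Fin 4) rfl rfl (by decide) (by decide))
  · exact key D11 (coFin D11) (h _ (by simp [forbidden]))
      (isIndContained_of_map (![0, 1, 2, 3] : Fin 4 → Fin 4) rfl rfl (by decide) (by decide))
  · exact key D12 D15 (h _ (by simp [forbidden]))
      (isIndContained_of_map (![2, 3, 0, 1] : Fin 4 → Fin 4) rfl rfl (by decide) (by decide))
  · exact key D13 D13 (h _ (by simp [forbidden]))
      (isIndContained_of_map (![2, 3, 0, 1] : Fin 4 → Fin 4) rfl rfl (by decide) (by decide))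
  · exact key D14 D14 (h _ (by simp [forbidden]))
      (isIndContained_of_map (![2, 3, 0, 1] : Fin 4 → Fin 4) rfl rfl (by decide) (by decide))
  · exact key D15 D12 (h _ (by simp [forbidden]))
      (isIndContained_of_map (![2, 3, 0, 1] : Fin 4 → Fin 4) rfl rfl (by decide) (by decide))
  · exact key (coFin D11) D11 (h _ (by simp [forbidden]))
      (isIndContained_of_map (![0, 1, 2, 3] : Fin 4 → Fin 4) rfl rfl (by decide) (by decide))
  · exact key (coFin D10) D10 (h _ (by simp [forbidden]))
      (isIndContained_of_map (![0, 1, 2, 3] : Fin 4 → Fin 4) rfl rfl (by decide) (by decide))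
  · exact key (coFin D9) D9 (h _ (by simp [forbidden]))
      (isIndContained_of_map (![0, 1, 2, 3] : Fin 4 → Fin 4) rfl rfl (by decide) (by decide))

end LDigraph

/-! ### No alternating 4-cycle in the underlying graph -/

namespace LDigraph

/-- This turns the absence of `F` into a propositional statement about the arcs among given
vertices, so that the case analyses below become finite and purely logical. -/
lemma not_isIndContained_three {V : Type u} {G : LDigraph V} {F : LDigraph (Fin 3)}
    (h : ¬ F.IsIndContained G) {a b c : V} (hab : a ≠ b) (hac : a ≠ c) (hbc : b ≠ c) :
    ¬ ((G.Adj a b ↔ F.Adj 0 1) ∧ (G.Adj b a ↔ F.Adj 1 0) ∧ (G.Adj a c ↔ F.Adj 0 2) ∧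
      (G.Adj c a ↔ F.Adj 2 0) ∧ (G.Adj b c ↔ F.Adj 1 2) ∧ (G.Adj c b ↔ F.Adj 2 1)) := by
  intro hE
  refine h ⟨⟨⟨![a, b, c], fun i j => ?_⟩, @fun i j => ?_⟩⟩
  · fin_cases i <;> fin_cases j <;> simp [hab, hac, hbc, hab.symm, hac.symm, hbc.symm]
  · change G.Adj (![a, b, c] i) (![a, b, c] j) ↔ F.Adj i j
    fin_cases i <;> fin_cases j <;> simp [hE, G.loopless, F.loopless]

lemma not_isIndContained_four {V : Type u} {G : LDigraph V} {F : LDigraph (Fin 4)}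
    (h : ¬ F.IsIndContained G) {a b c d : V} (hab : a ≠ b) (hac : a ≠ c) (had : a ≠ d)
    (hbc : b ≠ c) (hbd : b ≠ d) (hcd : c ≠ d) :
    ¬ ((G.Adj a b ↔ F.Adj 0 1) ∧ (G.Adj b a ↔ F.Adj 1 0) ∧ (G.Adj a c ↔ F.Adj 0 2) ∧
      (G.Adj c a ↔ F.Adj 2 0) ∧ (G.Adj a d ↔ F.Adj 0 3) ∧ (G.Adj d a ↔ F.Adj 3 0) ∧
      (G.Adj b c ↔ F.Adj 1 2) ∧ (G.Adj c b ↔ F.Adj 2 1) ∧ (G.Adj b d ↔ F.Adj 1 3) ∧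
      (G.Adj d b ↔ F.Adj 3 1) ∧ (G.Adj c d ↔ F.Adj 2 3) ∧ (G.Adj d c ↔ F.Adj 3 2)) := by
  intro hE
  refine h ⟨⟨⟨![a, b, c, d], fun i j => ?_⟩, @fun i j => ?_⟩⟩
  · fin_cases i <;> fin_cases j <;>
      simp [hab, hac, had, hbc, hbd, hcd, hab.symm, hac.symm, had.symm, hbc.symm, hbd.symm,
        hcd.symm]
  · change G.Adj (![a, b, c, d] i) (![a, b, c, d] j) ↔ F.Adj i j
    fin_cases i <;> fin_cases j <;> simp [hE, G.loopless, F.loopless]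

/-- A vertex adjacent to two nonadjacent vertices is joined to both of them in the same way. -/
lemma Free.fork {V : Type u} {G : LDigraph V} (hG : Free forbidden G) {u x w : V}
    (hxw : x ≠ w)
    (hx : G.Adj u x ∨ G.Adj x u) (hw : G.Adj u w ∨ G.Adj w u) (h1 : ¬ G.Adj x w)
    (h2 : ¬ G.Adj w x) : (G.Adj u x ↔ G.Adj u w) ∧ (G.Adj x u ↔ G.Adj w u) := by
  have hux : u ≠ x := hx.elim G.ne_of_adj fun h => (G.ne_of_adj h).symm
  have huw : u ≠ w := hw.elim G.ne_of_adj fun h => (G.ne_of_adj h).symm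
  have a1 := not_isIndContained_three (F := D1.2) (hG _ (by simp)) hux.symm hxw huw
  have a2 := not_isIndContained_three (F := D1.2) (hG _ (by simp)) huw.symm hxw.symm hux
  have b1 := not_isIndContained_three (F := D2.2) (hG _ (by simp)) hux.symm hxw huw
  have b2 := not_isIndContained_three (F := D2.2) (hG _ (by simp)) huw.symm hxw.symm hux
  have c1 := not_isIndContained_three (F := D3.2) (hG _ (by simp)) hux.symm hxw huw
  have c2 := not_isIndContained_three (F := D3.2) (hG _ (by simp)) huw.symm hxw.symm hux
  simp [D1, D2, D3, ofArcs] at a1 a2 b1 b2 c1 c2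
  grind

/-- The case of an alternating 4-cycle `x u v y` with `u` and `v` adjacent. -/
lemma Free.not_alternating_of_adj {V : Type u} {G : LDigraph V} (hG : Free forbidden G)
    {u v x y : V} (hux : G.Adj u x ∨ G.Adj x u) (hvy : G.Adj v y ∨ G.Adj y v)
    (huy : ¬ G.Adj u y) (hyu : ¬ G.Adj y u) (hvx : ¬ G.Adj v x) (hxv : ¬ G.Adj x v)
    (n4 : u ≠ y) (n5 : x ≠ v) (huv : G.Adj u v ∨ G.Adj v u) : False := by
  have n1 : u ≠ v := huv.elim G.ne_of_adj fun h => (G.ne_of_adj h).symm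
  have n2 : u ≠ x := hux.elim G.ne_of_adj fun h => (G.ne_of_adj h).symm
  have n3 : v ≠ y := hvy.elim G.ne_of_adj fun h => (G.ne_of_adj h).symm
  have n6 : x ≠ y := by rintro rfl; tauto
  -- The two forks give the edges of the underlying path `x u v y` a common type: all bidirectional,
  -- or single with alternating directions. Without an edge `x y` this is `D7` or `D8`; with one, a
  -- third fork yields `D9` or `D12`.
  have f1 := hG.fork n5 hux huv hxv hvx
  have f2 := hG.fork n4 huv.symm hvy huy hyu
  have d7 := not_isIndContained_four (F := D7.2) (hG _ (by simp)) n2.symm n5 n6 n1 n4 n3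
  have d8 := not_isIndContained_four (F := D8.2) (hG _ (by simp)) n3.symm n4.symm n6.symm n1.symm
    n5.symm n2
  have d8' := not_isIndContained_four (F := D8.2) (hG _ (by simp)) n2.symm n5 n6 n1 n4 n3
  have d9 := not_isIndContained_four (F := D9.2) (hG _ (by simp)) n4 n2 n1 n6.symm n3.symm n5
  have d12 := not_isIndContained_four (F := D12.2) (hG _ (by simp)) n4 n2 n1 n6.symm n3.symm n5
  have d12' := not_isIndContained_four (F := D12.2) (hG _ (by simp)) n5 n2.symm n6 n1.symm n3 n4
  simp [D7, D8, D9, D12, ofArcs] at d7 d8 d8' d9 d12 d12'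
  by_cases hxy : G.Adj x y ∨ G.Adj y x
  · have f3 := hG.fork n4 (hux.symm) hxy huy hyu
    grind
  · grind

/-- The underlying graph has no alternating 4-cycle. -/
lemma Free.not_alternating {V : Type u} {G : LDigraph V} (hG : Free forbidden G)
    {u v x y : V} (n1 : u ≠ v) (n6 : x ≠ y) (hux : G.un.Adj u x) (hvy : G.un.Adj v y)
    (huy : ¬ G.un.Adj u y) (hvx : ¬ G.un.Adj v x) (n4 : u ≠ y) (n5 : v ≠ x) : False := by
  simp only [un_adj] at hux hvy huy hvx
  have n2 : u ≠ x := hux.elim G.ne_of_adj fun h => (G.ne_of_adj h).symm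
  have n3 : v ≠ y := hvy.elim G.ne_of_adj fun h => (G.ne_of_adj h).symm
  obtain ⟨a1, a2⟩ := not_or.1 huy
  obtain ⟨a3, a4⟩ := not_or.1 hvx
  -- An edge between `u` and `v`, or by symmetry between `x` and `y`, is already excluded. The
  -- underlying graph on the four vertices is then `twoK2`, and the instances below run through the
  -- types and directions of its two edges.
  obtain ⟨a5, a6⟩ := not_or.1 (hG.not_alternating_of_adj hux hvy a1 a2 a3 a4 n4 n5.symm)
  obtain ⟨a7, a8⟩ := not_or.1
    (hG.not_alternating_of_adj hux.symm hvy.symm a4 a3 a2 a1 n5.symm n4)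
  have c9 := not_isIndContained_four (F := (coFin D9).2) (hG _ (by simp)) n2 n1 n4 n5.symm n6 n3
  have d1 := not_isIndContained_four (F := (coFin D10).2) (hG _ (by simp)) n2 n1 n4 n5.symm n6 n3
  have d2 := not_isIndContained_four (F := (coFin D10).2) (hG _ (by simp)) n2 n4 n1 n6 n5.symm
    n3.symm
  have d3 := not_isIndContained_four (F := (coFin D10).2) (hG _ (by simp)) n3 n1.symm n5 n4.symm
    n6.symm n2
  have d4 := not_isIndContained_four (F := (coFin D10).2) (hG _ (by simp)) n3 n5 n1.symm n6.symm
    n4.symm n2.symm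
  have e1 := not_isIndContained_four (F := (coFin D11).2) (hG _ (by simp)) n2 n1 n4 n5.symm n6 n3
  have e2 := not_isIndContained_four (F := (coFin D11).2) (hG _ (by simp)) n2 n4 n1 n6 n5.symm
    n3.symm
  have e3 := not_isIndContained_four (F := (coFin D11).2) (hG _ (by simp)) n2.symm n5.symm n6 n1 n4
    n3
  have e4 := not_isIndContained_four (F := (coFin D11).2) (hG _ (by simp)) n2.symm n6 n5.symm n4 n1
    n3.symm
  simp [coFin, LDigraph.co, D9, D10, D11, ofArcs, a1, a2, a3, a4, a5, a6, a7, a8]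
    at c9 d1 d2 d3 d4 e1 e2 e3 e4
  clear hG
  grind +splitImp

end LDigraph

/-! ### Extremal vertices in graphs and in transitive relations -/

namespace SimpleGraph

/-- A finite graph without alternating 4-cycles has an isolated or a dominating vertex. -/
lemma exists_isolated_or_dominating {V : Type u} [Finite V] [Nonempty V] (G : SimpleGraph V)
    (h : ∀ u v x y, u ≠ v → x ≠ y → G.Adj u x → G.Adj v y → ¬ G.Adj u y → ¬ G.Adj v x →
      u ≠ y → v ≠ x → False) :
    ∃ v, (∀ x, ¬ G.Adj v x) ∨ ∀ x, x ≠ v → G.Adj v x := by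
  -- Take `w` of maximum degree, a non-neighbour `y` of `w`, and a neighbour `x` of `y`. Without
  -- alternating 4-cycles the neighbours of `w` are neighbours of `x`, apart from `x` itself, and
  -- `y` is an extra one, so `x` has larger degree.
  obtain ⟨w, hw⟩ := Finite.exists_max fun v => (G.neighborSet v).ncard
  by_contra! hc
  obtain ⟨y, hyw, hwy⟩ := (hc w).2
  obtain ⟨x, hyx⟩ := (hc y).1
  have hsub : G.neighborSet w \ {x} ⊆ G.neighborSet x \ {w} := by
    rintro z ⟨hz, hzx⟩
    refine ⟨?_, hz.ne'⟩
    by_contra hxz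
    exact h x w y z (by rintro rfl; exact hwy hyx.symm) (by rintro rfl; exact hwy hz) hyx.symm hz
      hxz hwy (Ne.symm hzx) hyw.symm
  have hlt : (G.neighborSet w).ncard < (G.neighborSet x).ncard := by
    have hss : G.neighborSet w \ {x} ⊂ G.neighborSet x \ {w} :=
      ⟨hsub, fun hs => hwy (hs ⟨hyx.symm, hyw⟩).1⟩
    have := Set.ncard_lt_ncard hss (Set.toFinite _)
    -- If `w` and `x` are adjacent, both neighbourhoods lose one element in `hss`; otherwise neither
    -- does.
    by_cases hwx : G.Adj w x
    · have h1 := Set.ncard_sdiff_singleton_add_one (a := x) (s := G.neighborSet w) hwx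
      have h2 := Set.ncard_sdiff_singleton_add_one (a := w) (s := G.neighborSet x) hwx.symm
      omega
    · have h1 := Set.sdiff_singleton_eq_self (a := x) (s := G.neighborSet w) hwx
      have h2 := Set.sdiff_singleton_eq_self (a := w) (s := G.neighborSet x) fun h => hwx (SimpleGraph.Adj.symm h)
      rwa [h1, h2] at this
  exact absurd (hw x) (not_le.2 hlt)

end SimpleGraph

/-- Vertices adjacent to all the others in a locally transitive asymmetric relation: if none of
them is a source, then a minimal one has two unrelated predecessors. -/
lemma exists_minimal_with_unrelated_predecessors {V : Type u} [Finite V] (A : V → V → Prop)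
    (hA : ∀ x y, A x y → ¬ A y x)
    (htrans : ∀ v, (∀ x, x ≠ v → A v x ∨ A x v) → ∀ x y, A x v → A v y → A x y)
    (hex : ∃ v, ∀ x, x ≠ v → A v x ∨ A x v)
    (hsrc : ∀ v, (∀ x, x ≠ v → A v x ∨ A x v) → ∃ x, A x v) :
    ∃ v, (∀ x, x ≠ v → A v x ∨ A x v) ∧ (∀ w, (∀ x, x ≠ w → A w x ∨ A x w) → ¬ A w v) ∧
      ∃ a b, a ≠ b ∧ A a v ∧ A b v ∧ ¬ A a b ∧ ¬ A b a := by
  obtain ⟨v, hv, hmin⟩ := Set.exists_min_image {v | ∀ x, x ≠ v → A v x ∨ A x v}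
    (fun v => {x | A x v}.ncard) (Set.toFinite _) hex
  have hno : ∀ w, (∀ x, x ≠ w → A w x ∨ A x w) → ¬ A w v := by
    intro w hw hwv
    have hss : {x | A x w} ⊂ {x | A x v} :=
      ⟨fun x hx => htrans w hw x v hx hwv, fun hs => hA w w (hs hwv) (hs hwv)⟩
    exact absurd (hmin w hw) (not_le.2 (Set.ncard_lt_ncard hss (Set.toFinite _)))
  refine ⟨v, hv, hno, ?_⟩
  obtain ⟨a, ha⟩ := hsrc v hv
  have : ¬ ∀ x, x ≠ a → A a x ∨ A x a := fun h => hno a h ha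
  push Not at this
  obtain ⟨b, hba, hab, hba'⟩ := this
  have hbv : b ≠ v := fun h => hab (h ▸ ha)
  rcases hv b hbv with h | h
  · exact (hab (htrans v hv a b ha h)).elim
  · exact ⟨a, b, hba.symm, ha, h, hab, hba'⟩

/-! ### Existence of a uniform vertex -/

namespace LDigraph

lemma Free.induce {V : Type u} {G : LDigraph V} {X : Set FinDigraph} (hG : Free X G) (S : Set V) :
    Free X (G.induce S) :=
  fun F hF ⟨e⟩ => hG F hF ⟨e.trans (G.induceEmbedding S)⟩

/-- Single arcs. -/
def SingleArc {V : Type u} (G : LDigraph V) (x y : V) : Prop := G.Adj x y ∧ ¬ G.Adj y x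

/-- The single arcs at a vertex with only single arcs are transitive. -/
lemma Free.singleArc_trans {V : Type u} {G : LDigraph V} (hG : Free forbidden G) (v : V)
    (x y : V) (hxv : G.SingleArc x v) (hvy : G.SingleArc v y) : G.SingleArc x y := by
  have n1 := G.ne_of_adj hxv.1
  have n2 := G.ne_of_adj hvy.1
  have n3 : x ≠ y := by rintro rfl; exact hxv.2 hvy.1
  -- The alternatives to a single arc from `x` to `y` are no arc (`D1`), both arcs (`D4`), and the
  -- reverse single arc (`D5`).
  have d1 := not_isIndContained_three (F := D1.2) (hG _ (by simp)) n1 n3 n2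
  have d4 := not_isIndContained_three (F := D4.2) (hG _ (by simp)) n3 n1 n2.symm
  have d5 := not_isIndContained_three (F := D5.2) (hG _ (by simp)) n1 n3 n2
  simp [D1, D4, D5, ofArcs] at d1 d4 d5
  unfold SingleArc at *
  grind

/-- If the underlying graph has a dominating vertex and some vertex lies on no bidirectional arc,
then some vertex is joined to all the others by single arcs. -/
lemma Free.exists_all_singleArc {V : Type u} {G : LDigraph V} (hG : Free forbidden G) {u w : V}
    (hu : ∀ x, x ≠ u → G.Adj u x ∨ G.Adj x u) (hw : ∀ x, ¬ (G.Adj w x ∧ G.Adj x w)) :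
    ∃ v, ∀ x, x ≠ v → G.SingleArc v x ∨ G.SingleArc x v := by
  -- In fact `u` or `w` will do. Otherwise `u` has a bidirectional neighbour `x`, and `w` a
  -- non-neighbour `y`. The forks make `w` and `y` attach by single arcs, in the same way, to each
  -- of `u` and `x`. Excluding `D4` gives these arcs one common direction, so `D14` or `D13`
  -- appears.
  by_contra! hc
  obtain ⟨x, hxu, hx1, hx2⟩ := hc u
  obtain ⟨y, hyw, hy1, hy2⟩ := hc w
  unfold SingleArc at *
  have n1 : u ≠ w := by rintro rfl; grind
  have n2 : x ≠ w := by rintro rfl; grind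
  have n3 : y ≠ u := by rintro rfl; grind
  have n4 : x ≠ y := by
    rintro rfl
    have := hG.fork (u := u) n2
    grind
  have hux := hu x hxu
  have huy := hu y n3
  have huw := hu w n1.symm
  have hwx := hw x
  have hwu := hw u
  have hwy := hw y
  have f1 := hG.fork (u := u) (x := y) (w := w) hyw huy huw (by grind) (by grind)
  have f2 := hG.fork (u := u) (x := x) (w := w) n2
  have f3 := hG.fork (u := u) (x := x) (w := y) n4
  have f4 := hG.fork (u := x) (x := w) (w := y) hyw.symm
  have a1 := not_isIndContained_three (F := D4.2) (hG _ (by simp)) hxu.symm n1 n2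
  have a2 := not_isIndContained_three (F := D4.2) (hG _ (by simp)) hxu n2 n1
  have a3 := not_isIndContained_three (F := D4.2) (hG _ (by simp)) hxu.symm n3.symm n4
  have a4 := not_isIndContained_three (F := D4.2) (hG _ (by simp)) hxu n4 n3.symm
  have d14 := not_isIndContained_four (F := D14.2) (hG _ (by simp)) hxu.symm n1 n3.symm n2 n4
    hyw.symm
  have d13 := not_isIndContained_four (F := D13.2) (hG _ (by simp)) hyw.symm n1.symm n2.symm n3
    n4.symm hxu.symm
  simp [D4, D13, D14, ofArcs] at a1 a2 a3 a4 d13 d14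
  clear hG hc hu hw
  grind +splitImp

theorem Free.exists_uniform {V : Type u} [Finite V] [Nonempty V] {G : LDigraph V}
    (hG : Free forbidden G) : ∃ v, IsUniformIn G.Adj Set.univ v := by
  by_contra! hc
  obtain ⟨u, hu⟩ := G.un.exists_isolated_or_dominating
    fun u v x y h1 h2 h3 h4 h5 h6 h7 h8 => hG.not_alternating h1 h2 h3 h4 h5 h6 h7 h8
  obtain ⟨w, hw⟩ := G.co.un.exists_isolated_or_dominating
    fun u v x y h1 h2 h3 h4 h5 h6 h7 h8 => hG.co.not_alternating h1 h2 h3 h4 h5 h6 h7 h8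
  simp only [un_adj, LDigraph.co] at hu hw
  -- An isolated vertex of the underlying graph would be uniform, so `u` is dominating. In the
  -- complement, likewise, `w` is dominating, which says that `w` lies on no bidirectional arc of
  -- `G`.
  have hu' : ∀ x, x ≠ u → G.Adj u x ∨ G.Adj x u := by
    refine hu.resolve_left fun h => hc u fun x _ y _ _ _ => ?_
    have hx := h x
    have hy := h y
    tauto
  have hw' : ∀ x, ¬ (G.Adj w x ∧ G.Adj x w) := by
    have := hw.resolve_left fun h => hc w fun x _ y _ hxw hyw => by
      have hx := h x
      have hy := h y
      have := hxw.symm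
      have := hyw.symm
      tauto
    rintro x ⟨h1, h2⟩
    have := this x (G.ne_of_adj h2)
    tauto
  have hex := hG.exists_all_singleArc hu' hw'
  have hsingle : ∀ v, (∀ x, x ≠ v → G.SingleArc v x ∨ G.SingleArc x v) →
      (∃ x, G.SingleArc x v) ∧ ∃ x, G.SingleArc v x := by
    intro v hv
    constructor
    · by_contra! hn
      refine hc v fun x _ y _ hx hy => ?_
      have hx := (hv x hx).resolve_right (hn x)
      have hy := (hv y hy).resolve_right (hn y)
      simp [hx.1, hx.2, hy.1, hy.2]
    · by_contra! hn
      refine hc v fun x _ y _ hx hy => ?_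
      have hx := (hv x hx).resolve_left (hn x)
      have hy := (hv y hy).resolve_left (hn y)
      simp [hx.1, hx.2, hy.1, hy.2]
  have htrans := hG.singleArc_trans
  obtain ⟨v, hv, -, a, a', hne, ha, ha', h1, h2⟩ := exists_minimal_with_unrelated_predecessors
    G.SingleArc (fun x y h h' => h.2 h'.1) (fun v _ => htrans v) hex fun v hv => (hsingle v hv).1
  -- The reversed relation provides the last vertex of this kind, with two successors not joined by
  -- a single arc.
  obtain ⟨w, hw, hwmax, b, b', hne', hb, hb', h3, h4⟩ :=
    exists_minimal_with_unrelated_predecessors (fun x y => G.SingleArc y x)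
      (fun x y h h' => h.2 h'.1) (fun v _ x y hx hy => htrans v y x hy hx)
      (by simpa only [or_comm] using hex)
      fun v hv => (hsingle v (by simpa only [or_comm] using hv)).2
  -- Either `v = w` or there is a single arc from `v` to `w`, as the maximality of `w` excludes the
  -- reverse; transitivity then leads from `a` to `b`.
  have key : ∀ a b, G.SingleArc a v → G.SingleArc w b → G.SingleArc a b := by
    intro a b ha hb
    by_cases hvw : w = v
    · exact htrans v a b ha (hvw ▸ hb)
    · rcases hv w hvw with h | h
      · exact htrans w a b (htrans v a w ha h) hb
      · exact (hwmax v (by simpa only [or_comm] using hv) h).elim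
  have k1 := key a b ha hb
  have k2 := key a b' ha hb'
  have k3 := key a' b ha' hb
  have k4 := key a' b' ha' hb'
  have d12 := not_isIndContained_four (F := D12.2) (hG _ (by simp)) hne (G.ne_of_adj k1.1)
    (G.ne_of_adj k2.1) (G.ne_of_adj k3.1) (G.ne_of_adj k4.1) hne'
  have d13 := not_isIndContained_four (F := D13.2) (hG _ (by simp)) hne (G.ne_of_adj k1.1)
    (G.ne_of_adj k2.1) (G.ne_of_adj k3.1) (G.ne_of_adj k4.1) hne'
  have d14 := not_isIndContained_four (F := D14.2) (hG _ (by simp)) hne (G.ne_of_adj k1.1)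
    (G.ne_of_adj k2.1) (G.ne_of_adj k3.1) (G.ne_of_adj k4.1) hne'
  have d15 := not_isIndContained_four (F := D15.2) (hG _ (by simp)) hne (G.ne_of_adj k1.1)
    (G.ne_of_adj k2.1) (G.ne_of_adj k3.1) (G.ne_of_adj k4.1) hne'
  simp [D12, D13, D14, D15, ofArcs] at d12 d13 d14 d15
  unfold SingleArc at *
  grind

theorem Free.hasUniform {V : Type u} [Finite V] {G : LDigraph V}
    (hG : Free forbidden G) : HasUniform G.Adj := by
  intro S hS
  have := hS.to_subtype
  obtain ⟨v, hv⟩ := (hG.induce S).exists_uniform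
  refine ⟨v, v.2, fun x hx y hy hxv hyv => ?_⟩
  exact hv ⟨x, hx⟩ trivial ⟨y, hy⟩ trivial (fun h => hxv (h ▸ rfl)) (fun h => hyv (h ▸ rfl))

end LDigraph

namespace LDigraph

/-! ### Threshold underlying graphs -/

lemma IsThreshold.un_glue_bullet {V : Type u} {G : LDigraph V} (h : IsThreshold G.un)
    (p q : Prop) : IsThreshold (G.glue bullet (fun _ _ => p) (fun _ _ => q)).un := by
  by_cases hpq : p ∨ q
  · refine .iso ⟨Equiv.refl _, ?_⟩ h.join
    rintro (a | a) (b | b) <;> simp [un_adj, glue, bullet] <;> tauto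
  · refine .iso ⟨Equiv.refl _, ?_⟩ h.disjUnion
    rintro (a | a) (b | b) <;> simp [un_adj, glue, bullet] <;> tauto

/-- An isomorphism of digraphs is an isomorphism of the underlying graphs. -/
def Iso.un {V W : Type u} {G : LDigraph V} {H : LDigraph W} (e : Iso G H) : G.un ≃g H.un where
  toEquiv := e.toEquiv
  map_rel_iff' {a b} := by
    have h1 := e.map_rel_iff (a := a) (b := b)
    have h2 := e.map_rel_iff (a := b) (b := a)
    simp only [un_adj, RelIso.coe_fn_toEquiv, h1, h2]

lemma IsDirectedThreshold.isThreshold_un {V : Type u} {G : LDigraph V}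
    (h : IsDirectedThreshold G) : IsThreshold G.un := by
  induction h with
  | single =>
    refine .iso ⟨Equiv.refl _, ?_⟩ .single
    simp [bullet]
  | disjUnion _ ih => exact IsThreshold.un_glue_bullet ih _ _
  | order_bullet _ ih => exact IsThreshold.un_glue_bullet ih _ _
  | bullet_order _ ih =>
    exact .iso (glueComm _ _ _ _).un (IsThreshold.un_glue_bullet ih False True)
  | series _ ih => exact IsThreshold.un_glue_bullet ih _ _
  | iso e _ ih => exact .iso e.un ih

/-! ### Linear NLC-width one -/

lemma linearNLC_one_iff {V : Type u} (G : LDigraph V) :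
    (∃ lab, LinearNLC 1 G lab) ↔ IsDirectedThreshold G := by
  constructor
  · rintro ⟨lab, h⟩
    induction h with
    | single => exact .single
    | @add V G lab a S T _ ih =>
      -- With one label the relations `S` and `T` only decide whether they contain `(0, 0)`, so the
      -- new vertex is uniform.
      have hS : ∀ x, (lab x, a) = (0, 0) := fun x => Subsingleton.elim _ _
      simp only [hS]
      exact ih.glue_bullet _ _
    | relabel _ _ ih => exact ih
    | iso e _ ih => exact .iso e ih
  · intro h
    have add : ∀ {V : Type u} {G : LDigraph V} (p q : Prop), (∃ lab, LinearNLC 1 G lab) →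
        ∃ lab, LinearNLC 1 (G.glue bullet (fun _ _ => p) (fun _ _ => q)) lab :=
      fun p q ⟨lab, h⟩ => ⟨_, .add 0 {_x | p} {_x | q} h⟩
    induction h with
    | single => exact ⟨_, .single 0⟩
    | disjUnion _ ih => exact add _ _ ih
    | order_bullet _ ih => exact add _ _ ih
    | bullet_order _ ih =>
      obtain ⟨lab, h⟩ := add False True ih
      exact ⟨_, .iso (glueComm _ _ _ _) h⟩
    | series _ ih => exact add _ _ ih
    | iso e _ ih =>
      obtain ⟨lab, h⟩ := ih
      exact ⟨_, .iso e h⟩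

/-- A finite value excludes the empty infimum, which is `⊤`, and a nonempty infimum in `ℕ∞` is
attained. -/
lemma iInf_natCast_eq_iff {P : ℕ → Prop} {n : ℕ} :
    ⨅ k : {k : ℕ // P k}, (k.1 : ℕ∞) = n ↔ P n ∧ ∀ k, P k → n ≤ k := by
  constructor
  · intro h
    have hne : Nonempty {k : ℕ // P k} := by
      by_contra hn
      rw [not_nonempty_iff] at hn
      rw [iInf_of_empty] at h
      exact ENat.top_ne_natCast n h
    obtain ⟨k, hk⟩ := ENat.exists_eq_iInf (fun k : {k : ℕ // P k} => (k.1 : ℕ∞))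
    rw [h, Nat.cast_inj] at hk
    refine ⟨hk ▸ k.2, fun m hm => ?_⟩
    rw [← Nat.cast_le (α := ℕ∞), ← h]
    exact iInf_le (fun k : {k : ℕ // P k} => (k.1 : ℕ∞)) ⟨m, hm⟩
  · rintro ⟨hn, hle⟩
    exact le_antisymm (iInf_le (fun k : {k : ℕ // P k} => (k.1 : ℕ∞)) ⟨n, hn⟩)
      (le_iInf fun k => Nat.cast_le.2 (hle k.1 k.2))

theorem linearNLCWidth_eq_one_iff {V : Type u} [Nonempty V] (G : LDigraph V) :
    G.linearNLCWidth = 1 ↔ IsDirectedThreshold G := by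
  rw [← linearNLC_one_iff, linearNLCWidth]
  refine (iInf_natCast_eq_iff (n := 1)).trans ⟨And.left, fun h => ⟨h, fun k ⟨lab, _⟩ => ?_⟩⟩
  exact Nat.one_le_iff_ne_zero.2 fun hk => by
    subst hk
    exact (lab (Classical.arbitrary V)).elim0

/-! ### Neighbourhood-width one -/

/-- Seen from the later vertex `z`, width at most one means that `z` is uniform to all earlier
vertices, so the layout is an order of insertion. -/
lemma layoutWidth_le_one_iff {V : Type u} (G : LDigraph V) (φ : V ≃ Fin (Nat.card V)) :
    G.layoutWidth φ ≤ 1 ↔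
      ∀ x y z, φ x < φ z → φ y < φ z → (G.Adj x z ↔ G.Adj y z) ∧ (G.Adj z x ↔ G.Adj z y) := by
  simp only [layoutWidth, iSup_le_iff, Set.encard_le_one_iff]
  constructor
  · intro h x y z hx hy
    -- The cut just after the later of `x` and `y` has both on its left and `z` on its right.
    have := h (max (φ x) (φ y)) _ _ ⟨x, by simp, rfl⟩ ⟨y, by simp, rfl⟩
    simp only [nbhd, Prod.mk.injEq, Set.ext_iff, Set.mem_ofPred_eq] at this
    have hz : max (φ x) (φ y) < φ z := max_lt hx hy
    have h1 := this.1 z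
    have h2 := this.2 z
    tauto
  · rintro h i _ _ ⟨x, hx, rfl⟩ ⟨y, hy, rfl⟩
    simp only [nbhd, Prod.mk.injEq, Set.ext_iff, Set.mem_ofPred_eq]
    constructor <;> refine fun z => and_congr_right fun hz => ?_
    · exact (h x y z (lt_of_le_of_lt hx hz) (lt_of_le_of_lt hy hz)).1
    · exact (h x y z (lt_of_le_of_lt hx hz) (lt_of_le_of_lt hy hz)).2

lemma one_le_layoutWidth {V : Type u} [Nonempty V] (G : LDigraph V)
    (φ : V ≃ Fin (Nat.card V)) : 1 ≤ G.layoutWidth φ := by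
  let v := Classical.arbitrary V
  refine le_trans ?_ (le_iSup _ (φ v))
  rw [Set.one_le_encard_iff_nonempty]
  exact ⟨_, v, le_refl (φ v), rfl⟩

lemma neighbourhoodWidth_eq_one_iff_exists {V : Type u} [Finite V] [Nonempty V] (G : LDigraph V) :
    G.neighbourhoodWidth = 1 ↔ ∃ φ : V ≃ Fin (Nat.card V),
      ∀ x y z, φ x < φ z → φ y < φ z → (G.Adj x z ↔ G.Adj y z) ∧ (G.Adj z x ↔ G.Adj z y) := by
  have : Nonempty (V ≃ Fin (Nat.card V)) := ⟨Finite.equivFin V⟩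
  simp only [← layoutWidth_le_one_iff, neighbourhoodWidth]
  constructor
  · intro h
    obtain ⟨φ, hφ⟩ := ENat.exists_eq_iInf G.layoutWidth
    exact ⟨φ, (hφ.trans h).le⟩
  · rintro ⟨φ, hφ⟩
    exact le_antisymm (iInf_le_of_le φ hφ) (le_iInf G.one_le_layoutWidth)

/-- The length `n` is left free so that the induction need not transport along equalities of
cardinalities; it is identified with `Nat.card V` afterwards. -/
lemma IsDirectedThreshold.exists_layout {V : Type u} {G : LDigraph V}
    (h : IsDirectedThreshold G) : ∃ (n : ℕ) (φ : V ≃ Fin n),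
      ∀ x y z, φ x < φ z → φ y < φ z → (G.Adj x z ↔ G.Adj y z) ∧ (G.Adj z x ↔ G.Adj z y) := by
  have add : ∀ {V : Type u} {G : LDigraph V} (p q : Prop), (∃ (n : ℕ) (φ : V ≃ Fin n),
      ∀ x y z, φ x < φ z → φ y < φ z → (G.Adj x z ↔ G.Adj y z) ∧ (G.Adj z x ↔ G.Adj z y)) →
      ∃ (n : ℕ) (φ : V ⊕ PUnit.{u + 1} ≃ Fin n), ∀ x y z, φ x < φ z → φ y < φ z →
        ((G.glue bullet (fun _ _ => p) (fun _ _ => q)).Adj x z ↔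
          (G.glue bullet (fun _ _ => p) (fun _ _ => q)).Adj y z) ∧
        ((G.glue bullet (fun _ _ => p) (fun _ _ => q)).Adj z x ↔
          (G.glue bullet (fun _ _ => p) (fun _ _ => q)).Adj z y) := by
    rintro V G p q ⟨n, φ, h⟩
    refine ⟨n + 1, (φ.sumCongr (Equiv.ofUnique _ (Fin 1))).trans finSumFinEquiv, ?_⟩
    rintro (x | x) (y | y) (z | z) hx hy
    · exact h x y z hx hy
    · simp [glue]
    all_goals
      rw [Fin.lt_def] at hx hy
      simp [-Fin.val_fin_lt] at hx hy
      try omega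
  have iso : ∀ {V W : Type u} {G : LDigraph V} {H : LDigraph W}, Iso G H →
      (∃ (n : ℕ) (φ : V ≃ Fin n),
      ∀ x y z, φ x < φ z → φ y < φ z → (G.Adj x z ↔ G.Adj y z) ∧ (G.Adj z x ↔ G.Adj z y)) →
      ∃ (n : ℕ) (φ : W ≃ Fin n),
      ∀ x y z, φ x < φ z → φ y < φ z → (H.Adj x z ↔ H.Adj y z) ∧ (H.Adj z x ↔ H.Adj z y) := by
    rintro V W G H e ⟨n, φ, h⟩
    refine ⟨n, e.toEquiv.symm.trans φ, fun x y z hx hy => ?_⟩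
    simpa only [e.symm.map_rel_iff] using h (e.symm x) (e.symm y) (e.symm z) hx hy
  induction h with
  | single =>
    refine ⟨1, Equiv.ofUnique _ _, fun x y z hx => ?_⟩
    exact absurd hx (by simp [Subsingleton.elim x z])
  | disjUnion _ ih => exact add _ _ ih
  | order_bullet _ ih => exact add _ _ ih
  | bullet_order _ ih => exact iso (glueComm _ _ _ _) (add False True ih)
  | series _ ih => exact add _ _ ih
  | iso e _ ih => exact iso e ih

theorem neighbourhoodWidth_eq_one_iff {V : Type u} [Finite V] [Nonempty V] (G : LDigraph V) :
    G.neighbourhoodWidth = 1 ↔ IsDirectedThreshold G := by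
  rw [neighbourhoodWidth_eq_one_iff_exists]
  constructor
  · rintro ⟨φ, h⟩
    refine isDirectedThreshold_of_hasUniform fun S hS => ?_
    obtain ⟨v, hv, hmax⟩ := Set.exists_max_image S φ (Set.toFinite S) hS
    refine ⟨v, hv, fun x hx y hy hxv hyv => ?_⟩
    exact (h x y v (lt_of_le_of_ne (hmax x hx) (φ.injective.ne hxv))
      (lt_of_le_of_ne (hmax y hy) (φ.injective.ne hyv))).symm
  · intro h
    obtain ⟨n, φ, hφ⟩ := h.exists_layout
    obtain rfl : n = Nat.card V := by simpa using (Nat.card_congr φ).symm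
    exact ⟨φ, hφ⟩

/-! ### Directed trivially perfect graphs -/

/-- Every nonempty set of vertices has a uniform vertex or splits into two nonempty parts without
arcs between them. -/
def UniformOrSplit {V : Type*} (r : V → V → Prop) : Prop :=
  ∀ S : Set V, S.Nonempty → (∃ v ∈ S, IsUniformIn r S v) ∨
    ∃ A ⊆ S, A.Nonempty ∧ (S \ A).Nonempty ∧ ∀ x ∈ A, ∀ y ∈ S \ A, ¬ r x y ∧ ¬ r y x

lemma HasUniform.uniformOrSplit {V : Type*} {r : V → V → Prop} (h : HasUniform r) :
    UniformOrSplit r := fun S hS => Or.inl (h S hS)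

/-- The statement of `UniformOrSplit` for the image of a set under an embedding. -/
lemma UniformOrSplit.image {V W : Type*} {r : V → V → Prop} {s : W → W → Prop}
    (h : UniformOrSplit r) (e : r ↪r s) {S : Set W} (hS : S.Nonempty) (hSe : S ⊆ Set.range e) :
    (∃ v ∈ S, IsUniformIn s S v) ∨
      ∃ A ⊆ S, A.Nonempty ∧ (S \ A).Nonempty ∧ ∀ x ∈ A, ∀ y ∈ S \ A, ¬ s x y ∧ ¬ s y x := by
  obtain ⟨T, rfl⟩ := Set.subset_range_iff_exists_image_eq.1 hSe
  rcases h T hS.of_image with ⟨v, hv, hu⟩ | ⟨A, hAT, hA, hTA, hAB⟩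
  · refine Or.inl ⟨e v, ⟨v, hv, rfl⟩, ?_⟩
    rintro _ ⟨x, hx, rfl⟩ _ ⟨y, hy, rfl⟩ hxv hyv
    simpa only [e.map_rel_iff] using
      hu x hx y hy (fun h => hxv (h ▸ rfl)) (fun h => hyv (h ▸ rfl))
  · refine Or.inr ⟨e '' A, Set.image_mono hAT, hA.image e, ?_, ?_⟩
    · rw [← Set.image_sdiff e.injective]
      exact hTA.image e
    · rw [← Set.image_sdiff e.injective]
      rintro _ ⟨x, hx, rfl⟩ _ ⟨y, hy, rfl⟩
      simpa only [e.map_rel_iff] using hAB x hx y hy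

lemma UniformOrSplit.glue_bullet {V : Type u} {G : LDigraph V} (h : UniformOrSplit G.Adj)
    (p q : Prop) : UniformOrSplit (G.glue bullet (fun _ _ => p) (fun _ _ => q)).Adj := by
  intro S hS
  by_cases hw : Sum.inr PUnit.unit ∈ S
  · refine Or.inl ⟨_, hw, ?_⟩
    rintro (x | x) - (y | y) - <;> simp [glue]
  · refine h.image ⟨⟨Sum.inl, Sum.inl_injective⟩, Iff.rfl⟩ hS ?_
    rintro (x | x) hx
    · exact ⟨x, rfl⟩
    · exact (hw hx).elim

lemma UniformOrSplit.disjUnion {V W : Type u} {G : LDigraph V} {H : LDigraph W}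
    (hG : UniformOrSplit G.Adj) (hH : UniformOrSplit H.Adj) :
    UniformOrSplit (G.disjUnion H).Adj := by
  intro S hS
  by_cases hl : ∃ x, Sum.inl x ∈ S
  · by_cases hr : ∃ y, Sum.inr y ∈ S
    · obtain ⟨x, hx⟩ := hl
      obtain ⟨y, hy⟩ := hr
      refine Or.inr ⟨{z ∈ S | z.isLeft}, Set.sep_subset _ _, ⟨_, hx, rfl⟩,
        ⟨_, hy, fun h => by simpa using h.2⟩, ?_⟩
      rintro (a | a) ⟨ha, ha'⟩ (b | b) ⟨hb, hb'⟩
      · exact (hb' ⟨hb, rfl⟩).elim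
      · exact ⟨id, id⟩
      · simp at ha'
      · simp at ha'
    · refine hG.image ⟨⟨Sum.inl, Sum.inl_injective⟩, Iff.rfl⟩ hS ?_
      rintro (x | x) hx
      · exact ⟨x, rfl⟩
      · exact (hr ⟨x, hx⟩).elim
  · refine hH.image ⟨⟨Sum.inr, Sum.inr_injective⟩, Iff.rfl⟩ hS ?_
    rintro (x | x) hx
    · exact (hl ⟨x, hx⟩).elim
    · exact ⟨x, rfl⟩

lemma UniformOrSplit.iso {V W : Type u} {G : LDigraph V} {H : LDigraph W}
    (h : UniformOrSplit G.Adj) (e : Iso G H) : UniformOrSplit H.Adj :=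
  fun _ hS => h.image e.toRelEmbedding hS fun y _ => e.surjective y

lemma IsDirectedTriviallyPerfect.uniformOrSplit {V : Type u} {G : LDigraph V}
    (h : IsDirectedTriviallyPerfect G) : UniformOrSplit G.Adj := by
  induction h with
  | single => exact (HasUniform.of_subsingleton _).uniformOrSplit
  | disjUnion _ _ ih ih' => exact ih.disjUnion ih'
  | order_bullet _ ih => exact ih.glue_bullet _ _
  | bullet_order _ ih => exact (ih.glue_bullet False True).iso (glueComm _ _ _ _)
  | series _ ih => exact ih.glue_bullet _ _
  | iso e _ ih => exact ih.iso e

lemma IsDirectedThreshold.isDirectedTriviallyPerfect {V : Type u} {G : LDigraph V}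
    (h : IsDirectedThreshold G) : IsDirectedTriviallyPerfect G := by
  induction h with
  | single => exact .single
  | disjUnion _ ih => exact ih.disjUnion .single
  | order_bullet _ ih => exact ih.order_bullet
  | bullet_order _ ih => exact ih.bullet_order
  | series _ ih => exact ih.series
  | iso e _ ih => exact .iso e ih

lemma hasUniform_co {V : Type u} {G : LDigraph V} (h : HasUniform G.Adj) :
    HasUniform G.co.Adj := by
  intro S hS
  obtain ⟨v, hv, hu⟩ := h S hS
  refine ⟨v, hv, fun x hx y hy hxv hyv => ?_⟩
  simp only [LDigraph.co, hu x hx y hy hxv hyv, hxv, hyv, hxv.symm, hyv.symm, ne_eq,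
    not_false_eq_true, true_and]

/-- Uniform vertices are the same in `G` and in `G.co`, so only a set split in both matters. All
arcs run between `C` and its complement in `S`, hence all of `S` lies on one side of the split by
`A`, which is absurd. -/
theorem hasUniform_of_uniformOrSplit_co {V : Type u} {G : LDigraph V}
    (h : UniformOrSplit G.Adj) (h' : UniformOrSplit G.co.Adj) : HasUniform G.Adj := by
  intro S hS
  rcases h S hS with h | ⟨A, hAS, ⟨a, ha⟩, ⟨b, hb⟩, hAB⟩
  · exact h
  rcases h' S hS with ⟨v, hv, hu⟩ | ⟨C, hCS, ⟨c, hc⟩, ⟨d, hd⟩, hCD⟩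
  · refine ⟨v, hv, fun x hx y hy hxv hyv => ?_⟩
    have := hu x hx y hy hxv hyv
    simpa only [LDigraph.co, hxv, hyv, hxv.symm, hyv.symm, ne_eq, not_false_eq_true, true_and,
      not_iff_not] using this
  · exfalso
    have adj : ∀ x ∈ C, ∀ y ∈ S \ C, G.Adj x y := by
      intro x hx y hy
      by_contra hn
      exact (hCD x hx y hy).1 ⟨fun h => hy.2 (h ▸ hx), hn⟩
    have side : ∀ x ∈ C, ∀ y ∈ S \ C, (x ∈ A ↔ y ∈ A) := by
      intro x hx y hy
      constructor
      · intro hxA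
        by_contra hyA
        exact (hAB x hxA y ⟨hy.1, hyA⟩).1 (adj x hx y hy)
      · intro hyA
        by_contra hxA
        exact (hAB y hyA x ⟨hCS hx, hxA⟩).2 (adj x hx y hy)
    have all : ∀ x ∈ S, (x ∈ A ↔ d ∈ A) := by
      intro x hx
      by_cases hxC : x ∈ C
      · exact side x hxC d hd
      · exact (side c hc x ⟨hx, hxC⟩).symm.trans (side c hc d hd)
    exact hb.2 ((all b hb.1).2 ((all a (hAS ha)).1 ha))

theorem isDirectedThreshold_iff_triviallyPerfect {V : Type u} [Finite V] [Nonempty V]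
    (G : LDigraph V) : IsDirectedThreshold G ↔
      IsDirectedTriviallyPerfect G ∧ IsDirectedTriviallyPerfect G.co :=
  ⟨fun h => ⟨h.isDirectedTriviallyPerfect,
    (isDirectedThreshold_of_hasUniform (hasUniform_co h.hasUniform)).isDirectedTriviallyPerfect⟩,
  fun h => isDirectedThreshold_of_hasUniform
    (hasUniform_of_uniformOrSplit_co h.1.uniformOrSplit h.2.uniformOrSplit)⟩

end LDigraph

namespace LDigraph

/-! ### Linear clique-width at most two -/

/-- Within `S`, the vertex `v` is uniform to `A`, nonadjacent to the vertices outside `A`, and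
these are joined to `A` by all the arcs by which `v` is joined to `A`. -/
structure IsTwoLabelLast {V : Type*} (r : V → V → Prop) (S : Set V) (v : V) (A : Set V) :
    Prop where
  uniform : ∀ x ∈ S, ∀ y ∈ S, x ≠ v → y ≠ v → x ∈ A → y ∈ A → (r v x ↔ r v y) ∧ (r x v ↔ r y v)
  nonadj : ∀ x ∈ S, x ≠ v → x ∉ A → ¬ r v x ∧ ¬ r x v
  follow : ∀ x ∈ S, ∀ y ∈ S, x ≠ v → y ≠ v → x ∈ A → y ∉ A → (r v x → r y x) ∧ (r x v → r x y)

lemma IsTwoLabelLast.image {V W : Type*} {r : V → V → Prop} {s : W → W → Prop} {S : Set V} {v : V}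
    {A : Set V} (h : IsTwoLabelLast r S v A) (f : V → W) (hf : Function.Injective f)
    (hs : ∀ x y, s (f x) (f y) ↔ r x y) : IsTwoLabelLast s (f '' S) (f v) (f '' A) := by
  constructor
  · rintro _ ⟨x, hx, rfl⟩ _ ⟨y, hy, rfl⟩ hxv hyv hxA hyA
    rw [hf.mem_set_image] at hxA hyA
    simpa only [hs] using h.uniform x hx y hy (fun e => hxv (e ▸ rfl)) (fun e => hyv (e ▸ rfl))
      hxA hyA
  · rintro _ ⟨x, hx, rfl⟩ hxv hxA
    rw [hf.mem_set_image] at hxA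
    simpa only [hs] using h.nonadj x hx (fun e => hxv (e ▸ rfl)) hxA
  · rintro _ ⟨x, hx, rfl⟩ _ ⟨y, hy, rfl⟩ hxv hyv hxA hyA
    rw [hf.mem_set_image] at hxA hyA
    simpa only [hs] using h.follow x hx y hy (fun e => hxv (e ▸ rfl)) (fun e => hyv (e ▸ rfl))
      hxA hyA

/-- The labels do not separate the vertices of `S`, or they separate `A` from the others. -/
def LabelsCompatible {V : Type*} {k : ℕ} (lab : V → Fin k) (S : Set V) (v : V) (A : Set V) :
    Prop :=
  (∀ x ∈ S, ∀ y ∈ S, lab x = lab y) ∨ ∀ x ∈ S, x ≠ v → (x ∈ A ↔ lab x ≠ lab v)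

lemma LabelsCompatible.image {V W : Type*} {k : ℕ} {lab : V → Fin k} {lab' : W → Fin k}
    {S : Set V} {v : V} {A : Set V} (h : LabelsCompatible lab S v A) (f : V → W)
    (hf : Function.Injective f) (hl : ∀ x, lab' (f x) = lab x) :
    LabelsCompatible lab' (f '' S) (f v) (f '' A) := by
  refine h.imp ?_ ?_
  · rintro h _ ⟨x, hx, rfl⟩ _ ⟨y, hy, rfl⟩
    simpa only [hl] using h x hx y hy
  · rintro h _ ⟨x, hx, rfl⟩ hxv
    simpa only [hl, hf.mem_set_image] using h x hx fun e => hxv (e ▸ rfl)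

/-- Take for `v` the last inserted vertex of `S`, and for `A` the vertices with a different label at
that moment. While both labels persist, arc insertions treat `A` alike, miss the pairs of `v` with
vertices outside `A`, and give those vertices every arc to or from `A` that `v` receives. They may
have older arcs, so `follow` is only an implication. Once the labels in `S` agree, no further arc is
inserted inside `S`. -/
lemma LinearCW.exists_isTwoLabelLast {k : ℕ} (hk : k ≤ 2) {V : Type u} {G : LDigraph V}
    {lab : V → Fin k} (h : LinearCW k G lab) :
    ∀ S : Set V, S.Nonempty →
      ∃ v ∈ S, ∃ A, IsTwoLabelLast G.Adj S v A ∧ LabelsCompatible lab S v A := by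
  -- This is where the bound `k ≤ 2` enters.
  have two : ∀ a b c : Fin k, a ≠ c → b ≠ c → a = b := fun a b c _ _ => by omega
  induction h with
  | single a =>
    rintro S ⟨v, hv⟩
    exact ⟨v, hv, ∅, ⟨by simp, by simp [bullet], by simp⟩, Or.inl fun _ _ _ _ => rfl⟩
  | @add V G lab a _ ih =>
    intro S hS
    by_cases hw : Sum.inr PUnit.unit ∈ S
    · refine ⟨_, hw, {x | Sum.elim lab (fun _ => a) x ≠ a}, ⟨?_, ?_, ?_⟩, Or.inr ?_⟩
      · rintro (x | x) - (y | y) - <;> simp [LDigraph.disjUnion, glue]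
      · rintro (x | x) - <;> simp [LDigraph.disjUnion, glue]
      · rintro (x | x) - (y | y) - <;> simp [LDigraph.disjUnion, glue]
      · simp
    · have hS' : S = Sum.inl '' (Sum.inl ⁻¹' S) := by
        refine (Set.image_preimage_eq_of_subset ?_).symm
        rintro (x | x) hx
        · exact ⟨x, rfl⟩
        · exact (hw hx).elim
      rw [hS'] at hS
      obtain ⟨v, hv, A, h1, h2⟩ := ih _ hS.of_image
      rw [hS']
      exact ⟨_, ⟨v, hv, rfl⟩, _, h1.image Sum.inl Sum.inl_injective fun _ _ => Iff.rfl,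
        h2.image Sum.inl Sum.inl_injective fun _ => rfl⟩
  | @insertArcs V G lab a b hab _ ih =>
    intro S hS
    obtain ⟨v, hv, A, h1, h2⟩ := ih S hS
    refine ⟨v, hv, A, ?_, h2⟩
    rcases h2 with h2 | h2
    · have hadj : ∀ x ∈ S, ∀ y ∈ S, ((G.insertArcs lab a b hab).Adj x y ↔ G.Adj x y) := by
        intro x hx y hy
        refine or_iff_left fun h => hab ?_
        rw [← h.1, ← h.2, h2 x hx y hy]
      refine ⟨fun x hx y hy => ?_, fun x hx => ?_, fun x hx y hy => ?_⟩
      · simpa only [hadj _ hx _ hv, hadj _ hv _ hx, hadj _ hy _ hv, hadj _ hv _ hy] using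
          h1.uniform x hx y hy
      · simpa only [hadj _ hx _ hv, hadj _ hv _ hx] using h1.nonadj x hx
      · simpa only [hadj _ hx _ hv, hadj _ hv _ hx, hadj _ hx _ hy, hadj _ hy _ hx] using
          h1.follow x hx y hy
    · refine ⟨fun x hx y hy hxv hyv hxA hyA => ?_, fun x hx hxv hxA => ?_,
        fun x hx y hy hxv hyv hxA hyA => ?_⟩
      · have h3 := h1.uniform x hx y hy hxv hyv hxA hyA
        have h4 := two _ _ _ ((h2 x hx hxv).1 hxA) ((h2 y hy hyv).1 hyA)
        simp only [LDigraph.insertArcs, h3, h4, and_self]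
      · have h3 := h1.nonadj x hx hxv hxA
        have h4 : lab x = lab v := not_not.1 fun h => hxA ((h2 x hx hxv).2 h)
        simp only [LDigraph.insertArcs, h3, h4, false_or]
        constructor <;> exact fun h => hab (h.1.symm.trans h.2)
      · have h3 := h1.follow x hx y hy hxv hyv hxA hyA
        have h4 : lab y = lab v := not_not.1 fun h => hyA ((h2 y hy hyv).2 h)
        simp only [LDigraph.insertArcs, h4]
        exact ⟨Or.imp_left h3.1, Or.imp_left h3.2⟩
  | @relabel V G lab a b _ ih =>
    intro S hS
    obtain ⟨v, hv, A, h1, h2⟩ := ih S hS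
    refine ⟨v, hv, A, h1, ?_⟩
    by_cases hab : a = b
    · have : (fun x => if lab x = a then b else lab x) = lab := by
        funext x
        split_ifs with h
        · rw [h, hab]
        · rfl
      rwa [this]
    -- With at most two labels, a proper relabelling merges them all.
    · have : ∀ x, (if lab x = a then b else lab x) = b := by
        intro x
        split_ifs with h
        · rfl
        · exact two _ _ a h (Ne.symm hab)
      exact Or.inl fun x _ y _ => by simp only [this]
  | @iso V W G H lab e _ ih =>
    intro S hS
    obtain ⟨v, hv, A, h1, h2⟩ := ih (e.symm '' S) (hS.image _)
    have hS' : S = e '' (e.symm '' S) := by simp [Set.image_image]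
    rw [hS']
    exact ⟨_, ⟨v, hv, rfl⟩, _, h1.image e e.injective fun _ _ => e.map_rel_iff,
      h2.image e e.injective fun x => by simp⟩

/-- The hypothesis `hF` says that no `v` and `A` satisfy `IsTwoLabelLast` on all of `F`; with `A`
given by a Boolean function, `decide` can check it. -/
lemma not_isIndContained_of_linearCW {k : ℕ} (hk : k ≤ 2) {V : Type u} {G : LDigraph V}
    {lab : V → Fin k} (h : LinearCW k G lab) (F : FinDigraph) [Nonempty (Fin F.1)]
    (hF : ∀ (v : Fin F.1) (A : Fin F.1 → Bool),
      (∃ x, x ≠ v ∧ A x = false ∧ (F.2.Adj v x ∨ F.2.Adj x v)) ∨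
      ∃ x y, x ≠ v ∧ y ≠ v ∧ A x = true ∧
        (A y = true ∧ ¬ ((F.2.Adj v x ↔ F.2.Adj v y) ∧ (F.2.Adj x v ↔ F.2.Adj y v)) ∨
        A y = false ∧ ¬ ((F.2.Adj v x → F.2.Adj y x) ∧ (F.2.Adj x v → F.2.Adj x y)))) :
    ¬ F.2.IsIndContained G := by
  classical
  rintro ⟨e⟩
  obtain ⟨_, ⟨v, rfl⟩, A, hA, -⟩ := h.exists_isTwoLabelLast hk (Set.range e) (Set.range_nonempty e)
  rcases hF v fun x => decide (e x ∈ A) with ⟨x, hx, hxA, hadj⟩ |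
    ⟨x, y, hx, hy, hxA, ⟨hyA, hn⟩ | ⟨hyA, hn⟩⟩
  · have := hA.nonadj (e x) ⟨x, rfl⟩ (e.injective.ne hx) (by simpa using hxA)
    simp only [e.map_rel_iff] at this
    tauto
  · have := hA.uniform (e x) ⟨x, rfl⟩ (e y) ⟨y, rfl⟩ (e.injective.ne hx) (e.injective.ne hy)
      (by simpa using hxA) (by simpa using hyA)
    simp only [e.map_rel_iff] at this
    exact hn this
  · have := hA.follow (e x) ⟨x, rfl⟩ (e y) ⟨y, rfl⟩ (e.injective.ne hx) (e.injective.ne hy)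
      (by simpa using hxA) (by simpa using hyA)
    simp only [e.map_rel_iff] at this
    exact hn this

theorem free_of_linearCW {k : ℕ} (hk : k ≤ 2) {V : Type u} {G : LDigraph V}
    {lab : V → Fin k} (h : LinearCW k G lab)
    (hG : Free {D2, D3, D9, D10, D12, D13, D14} G) : Free forbidden G := by
  have key := fun (F : FinDigraph) (h0 : Nonempty (Fin F.1)) =>
    not_isIndContained_of_linearCW hk h F
  rintro F (rfl | rfl | rfl | rfl | rfl | rfl | rfl | rfl | rfl | rfl | rfl | rfl | rfl | rfl | rfl |
    rfl | rfl | rfl)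
  · exact key D1 ⟨⟨0, by decide⟩⟩ (by decide)
  · exact hG D2 (by simp)
  · exact hG D3 (by simp)
  · exact key D4 ⟨⟨0, by decide⟩⟩ (by decide)
  · exact key D5 ⟨⟨0, by decide⟩⟩ (by decide)
  · exact key D6 ⟨⟨0, by decide⟩⟩ (by decide)
  · exact key D7 ⟨⟨0, by decide⟩⟩ (by decide)
  · exact key D8 ⟨⟨0, by decide⟩⟩ (by decide)
  · exact hG D9 (by simp)
  · exact hG D10 (by simp)
  · exact key D11 ⟨⟨0, by decide⟩⟩ (by decide)
  · exact hG D12 (by simp)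
  · exact hG D13 (by simp)
  · exact hG D14 (by simp)
  · exact key D15 ⟨⟨0, by decide⟩⟩ (by decide)
  · exact key (coFin D11) ⟨⟨0, by decide⟩⟩ (by decide)
  · exact key (coFin D10) ⟨⟨0, by decide⟩⟩ (by decide)
  · exact key (coFin D9) ⟨⟨0, by decide⟩⟩ (by decide)

lemma LinearCW.insertArcs_if {k : ℕ} {V : Type u} {G : LDigraph V} {lab : V → Fin k}
    (h : LinearCW k G lab) (a b : Fin k) (hab : a ≠ b) (p : Prop) {H : LDigraph V}
    (hH : ∀ x y, H.Adj x y ↔ G.Adj x y ∨ p ∧ lab x = a ∧ lab y = b) : LinearCW k H lab := by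
  by_cases hp : p
  · exact .iso (lab := lab) (G := G.insertArcs lab a b hab)
      ⟨Equiv.refl V, by simp [hH, hp, LDigraph.insertArcs]⟩ (.insertArcs a b hab h)
  · exact .iso (lab := lab) ⟨Equiv.refl V, by simp [hH, hp]⟩ h

lemma IsDirectedThreshold.linearCW {V : Type u} {G : LDigraph V} (h : IsDirectedThreshold G) :
    LinearCW 2 G (fun _ => 0) := by
  have add : ∀ {V : Type u} {G : LDigraph V} (p q : Prop), LinearCW 2 G (fun _ => 0) →
      LinearCW 2 (G.glue bullet (fun _ _ => p) (fun _ _ => q)) (fun _ => 0) := by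
    intro V G p q h
    -- All old vertices carry label 0. The new one gets label 1 while its arcs are inserted and is
    -- then relabelled to 0, which restores the invariant.
    have h1 := (h.add 1).insertArcs_if 0 1 (by decide) p
      (H := G.glue bullet (fun _ _ => p) (fun _ _ => False))
      (by rintro (x | x) (y | y) <;> simp [LDigraph.disjUnion, glue])
    have h2 := h1.insertArcs_if 1 0 (by decide) q
      (H := G.glue bullet (fun _ _ => p) (fun _ _ => q))
      (by rintro (x | x) (y | y) <;> simp [glue])
    convert h2.relabel 1 0 using 1
    funext x
    rcases x with x | x <;> rfl
  induction h with
  | single => exact .single 0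
  | disjUnion _ ih => exact add _ _ ih
  | order_bullet _ ih => exact add _ _ ih
  | bullet_order _ ih => exact .iso (glueComm _ _ _ _) (add False True ih)
  | series _ ih => exact add _ _ ih
  | iso e _ ih => exact .iso e ih

lemma linearCliqueWidth_le_two_iff {V : Type u} (G : LDigraph V) :
    G.linearCliqueWidth ≤ 2 ↔ ∃ k ≤ 2, ∃ lab : V → Fin k, LinearCW k G lab := by
  constructor
  · intro h
    have hne : Nonempty {k : ℕ // ∃ lab : V → Fin k, LinearCW k G lab} := by
      by_contra hn
      rw [not_nonempty_iff] at hn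
      rw [linearCliqueWidth, iInf_of_empty] at h
      exact absurd h (by decide)
    obtain ⟨k, hk⟩ := ENat.exists_eq_iInf
      (fun k : {k : ℕ // ∃ lab : V → Fin k, LinearCW k G lab} => (k.1 : ℕ∞))
    exact ⟨k.1, by exact_mod_cast hk.le.trans h, k.2⟩
  · rintro ⟨k, hk, h⟩
    exact (iInf_le (fun k : {k : ℕ // ∃ lab : V → Fin k, LinearCW k G lab} => (k.1 : ℕ∞))
      ⟨k, h⟩).trans (by exact_mod_cast hk)

end LDigraph

theorem mainTheorem2 {V : Type u} [Finite V] [Nonempty V] (G : LDigraph V) :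
    List.TFAE
      [IsDirectedThreshold G,
       Free {D1, D2, D3, D4, D5, D6, D7, D8, D9, D10, D11, D12, D13, D14, D15,
         coFin D11, coFin D10, coFin D9} G,
       Free {D1, D2, D3, D4, D5, D6, D10, D11, D13, D14, D15} G ∧
         ¬ (SimpleGraph.pathGraph 4).IsIndContained G.un ∧
         ¬ twoK2.IsIndContained G.un ∧
         ¬ (SimpleGraph.cycleGraph 4).IsIndContained G.un,
       Free {D1, D2, D3, D4, D5, D6, D10, D11, D13, D14, D15} G ∧ IsThreshold G.un,
       G.linearNLCWidth = 1,
       G.neighbourhoodWidth = 1,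
       G.linearCliqueWidth ≤ 2 ∧ Free {D2, D3, D9, D10, D12, D13, D14} G,
       IsDirectedTriviallyPerfect G ∧ IsDirectedTriviallyPerfect G.co] := by
  have sub : ∀ X : Set FinDigraph, X ⊆ forbidden → Free forbidden G → Free X G :=
    fun X hX h F hF => h F (hX hF)
  tfae_have 1 → 2 := fun h => free_of_hasUniform h.hasUniform
  tfae_have 2 → 1 := fun h => isDirectedThreshold_of_hasUniform h.hasUniform
  tfae_have 1 → 4 := fun h => ⟨sub _ (by simp [Set.insert_subset_iff]) (free_of_hasUniform h.hasUniform),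
    h.isThreshold_un⟩
  tfae_have 4 → 3 := fun h => ⟨h.1, un_free_of_hasUniform h.2.hasUniform⟩
  tfae_have 3 → 2 := fun h => free_of_un_free h.1 h.2.1 h.2.2.1 h.2.2.2
  tfae_have 5 ↔ 1 := G.linearNLCWidth_eq_one_iff
  tfae_have 6 ↔ 1 := G.neighbourhoodWidth_eq_one_iff
  tfae_have 1 → 7 := fun h => ⟨G.linearCliqueWidth_le_two_iff.2 ⟨2, le_rfl, _, h.linearCW⟩,
    sub _ (by simp [Set.insert_subset_iff]) (free_of_hasUniform h.hasUniform)⟩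
  tfae_have 7 → 2 := fun ⟨h, hG⟩ => by
    obtain ⟨k, hk, lab, h⟩ := G.linearCliqueWidth_le_two_iff.1 h
    exact free_of_linearCW hk h hG
  tfae_have 1 ↔ 8 := isDirectedThreshold_iff_triviallyPerfect G
  tfae_finish
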